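/- Let $d\ge 0$ be an integer and let $F\in C^3(\mathbb R)$ be even and nonnegative with $F(u)=0$ iff $u=\pm1$, $F'(u)=0$ iff $u\in\{0,\pm1\}$, $F''(0)<0$ and $F''(\pm1)>0$. Put $C_*=\int_{-1}^1\sqrt{2F(u)}\,du$. For $L>0$ and $a=1/n$ with $n\in\mathbb N$, let $D_L=(-L,L)\times(0,1)^d$ and $D_{L,a}=\big([-(L-a),L-a]\times[0,1]^d\big)\cap a\mathbb Z^{d+1}$. Fix a subdivision of the cubes of the grid into simplices whose vertices are corners of the cube, the same for every cube up to translation and for every $a$ up to scaling, such that simplices of neighbouring cubes fit together to a triangulation of $\mathbb R^{d+1}$. Let $\mathscr H^{L,a}$ be the affine space of functions $h:\overline{D_L}\to\mathbb R$ that are obtained by linear interpolation on the simplices from arbitrary values at the points of $D_{L,a}$ and the values $h(x,y)=1$ for $x\ge\lfloor L/a\rfloor a$ and $h(x,y)=-1$ for $x\le-\lfloor L/a\rfloor a$. Let $N=\dim\mathscr H^{L,a}$ and let $\mathcal L^N$ be the Lebesgue measure on $\mathscr H^{L,a}\cong\mathbb R^N$ in the coordinates $(h(z))_{z\in D_{L,a}}$.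 For $\varepsilon>0$ define $$\nu_1^\varepsilon(dh)=\frac1{Z_1^\varepsilon}\exp\Big(-\frac1{2\varepsilon}\int_{D_L}|\nabla h(z)|^2\,dz\Big)\mathcal L^N(dh),\qquad Z_1^\varepsilon=\int_{\mathscr H^{L,a}}\exp\Big(-\frac1{2\varepsilon}\int_{D_L}|\nabla h(z)|^2\,dz\Big)\mathcal L^N(dh),$$ $$Z^\varepsilon=\int_{\mathscr H^{L,a}}\exp\Big(-\frac1\varepsilon\int_{D_L}F(h(z))\,dz\Big)\,\nu_1^\varepsilon(dh).$$ Write $f(\varepsilon)\sim g(\varepsilon)$ if there are constants $0<c\le C$ with $c\,g(\varepsilon)\le f(\varepsilon)\le C\,g(\varepsilon)$ for all sufficiently small $\varepsilon>0$. Let $\lambda,\alpha>0$ with $\lambda+(d+1)\alpha<1$, and let $L=L(\varepsilon)\sim\varepsilon^{-\lambda}$ and $a=a(\varepsilon)=1/n(\varepsilon)\sim\varepsilon^{\alpha}$, $n(\varepsilon)\in\mathbb N$. Then $N=\dim\mathscr H^{L(\varepsilon),a(\varepsilon)}\sim\varepsilon^{-\lambda-(d+1)\alpha}$ and $$\liminf_{\varepsilon\downarrow0}\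 \varepsilon\log Z^\varepsilon\ \ge\ -C_*.$$ -/

import Mathlib

open MeasureTheory Filter Topology
open scoped ENNReal

namespace AllenCahn

/-- `ℝ^{d+1}` with its Euclidean structure. A point is `(x, y)` with `x` the coordinate of index `0`
and `y ∈ ℝ^d` the remaining coordinates. -/
abbrev Pt (d : ℕ) : Type := EuclideanSpace ℝ (Fin (d + 1))

/-- The standing assumptions on the double-well potential `F`: it is `C³`, even and nonnegative,
vanishes exactly at `±1`, has critical points exactly `0, ±1`, and `F''(0) < 0`, `F''(±1) > 0`. -/
structure IsDoubleWell (F : ℝ → ℝ) : Prop where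
  contDiff : ContDiff ℝ 3 F
  even : ∀ u, F (-u) = F u
  nonneg : ∀ u, 0 ≤ F u
  eq_zero_iff : ∀ u, F u = 0 ↔ u = 1 ∨ u = -1
  deriv_eq_zero_iff : ∀ u, deriv F u = 0 ↔ u = 0 ∨ u = 1 ∨ u = -1
  deriv2_zero_neg : deriv (deriv F) 0 < 0
  deriv2_one_pos : 0 < deriv (deriv F) 1
  deriv2_neg_one_pos : 0 < deriv (deriv F) (-1)

/-- The constant `C_* = ∫_{-1}^1 √(2F(u)) du`. -/
noncomputable def Cstar (F : ℝ → ℝ) : ℝ := ∫ u in (-1 : ℝ)..1, Real.sqrt (2 * F u)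

/-- The cuboid `D_L = (-L, L) × (0,1)^d`. -/
def domain (d : ℕ) (L : ℝ) : Set (Pt d) :=
  {z | z 0 ∈ Set.Ioo (-L) L ∧ ∀ i : Fin d, z i.succ ∈ Set.Ioo (0 : ℝ) 1}

/-- The closed cuboid `[-L, L] × [0,1]^d`. -/
def closedDomain (d : ℕ) (L : ℝ) : Set (Pt d) :=
  {z | z 0 ∈ Set.Icc (-L) L ∧ ∀ i : Fin d, z i.succ ∈ Set.Icc (0 : ℝ) 1}

/-- The mesh size `a = 1/n`. -/
noncomputable def mesh (n : ℕ) : ℝ := 1 / (n : ℝ)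

/-- The lattice domain `D_{L,a}`: the points of `a ℤ^{d+1}` in `[-(L-a), L-a] × [0,1]^d`,
with `a = 1/n`. -/
def latticeDomain (d : ℕ) (L : ℝ) (n : ℕ) : Set (Pt d) :=
  {z | z ∈ closedDomain d (L - mesh n) ∧ ∀ i, ∃ k : ℤ, z i = mesh n * k}

theorem latticeDomain_finite (d : ℕ) (L : ℝ) (n : ℕ) : (latticeDomain d L n).Finite := by
  set M : ℝ := max |L - mesh n| 1 with hM
  have h1 : (latticeDomain d L n) ⊆ (fun k : Fin (d + 1) → ℤ =>
      (WithLp.toLp 2 (fun i => mesh n * (k i : ℝ)) : Pt d)) ''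
        (Set.pi Set.univ fun _ => Set.Icc (-⌈n * M⌉) ⌈n * M⌉) := by
    rintro z ⟨hz, hk⟩
    have hzM : ∀ i, |z i| ≤ M := by
      intro i
      refine Fin.cases ?_ (fun j => ?_) i
      · have := hz.1
        exact (abs_le.2 ⟨by have := le_abs_self (L - mesh n); linarith [hz.1.1],
          by have := le_abs_self (L - mesh n); linarith [hz.1.2]⟩ :
            |z 0| ≤ |L - mesh n|).trans (le_max_left _ _)
      · have := hz.2 j
        exact (abs_le.2 ⟨by linarith [this.1], this.2⟩).trans (le_max_right _ _)
    rcases Nat.eq_zero_or_pos n with hn | hn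
    · subst hn
      refine ⟨fun _ => 0, by simp, ?_⟩
      ext i
      obtain ⟨k, hk⟩ := hk i
      simp [hk, mesh]
    · choose k hk using hk
      have hn' : (0 : ℝ) < n := by exact_mod_cast hn
      refine ⟨k, ?_, ?_⟩
      · intro i _
        have h := hzM i
        rw [hk i, mesh, one_div, abs_mul, abs_of_pos (inv_pos.2 hn'),
          inv_mul_le_iff₀ hn'] at h
        have h2 := abs_le.1 (h.trans (Int.le_ceil _))
        exact ⟨by exact_mod_cast h2.1, by exact_mod_cast h2.2⟩
      · ext i
        simp [hk]
  refine Set.Finite.subset (Set.Finite.image _ ?_) h1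
  exact Set.Finite.pi fun _ => Set.finite_Icc _ _

noncomputable instance latticeDomainFintype (d : ℕ) (L : ℝ) (n : ℕ) :
    Fintype (latticeDomain d L n) := (latticeDomain_finite d L n).fintype

/-- A way to subdivide the unit cubes of the lattice `ℤ^{d+1}` into simplices, the same in every
cube: a triangulation of `ℝ^{d+1}`, invariant under integer translations, each simplex of which
is spanned by corners of one unit cube `k + [0,1]^{d+1}`. Scaling by `a` gives the subdivision of
the cubes of side length `a` of the grid. -/
structure CubeSubdivision (d : ℕ) extends Geometry.SimplicialComplex ℝ (Pt d) where
  space_eq_univ : toSimplicialComplex.space = Set.univ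
  corners : ∀ s ∈ faces, ∃ k : Fin (d + 1) → ℤ, ∀ v ∈ s, ∀ i, v i = k i ∨ v i = k i + 1
  translate : ∀ s ∈ faces, ∀ k : Fin (d + 1) → ℤ,
    s.map (addRightEmbedding (WithLp.toLp 2 (fun i => (k i : ℝ)) : Pt d)) ∈ faces

/-- `y` is the value at `x` of the linear interpolation of the values `u` at the vertices of a
simplex, scaled by `a`, that contains `x`. -/
def IsInterpolation {d : ℕ} (T : CubeSubdivision d) (a : ℝ) (u : Pt d → ℝ) (x : Pt d) (y : ℝ) :
    Prop :=
  ∃ s ∈ T.faces, ∃ w : Pt d → ℝ, (∀ v ∈ s, 0 ≤ w v) ∧ ∑ v ∈ s, w v = 1 ∧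
    ∑ v ∈ s, w v • (a • v) = x ∧ ∑ v ∈ s, w v * u (a • v) = y

open Classical in
/-- The piecewise linear interpolation of the values of `u` on the grid `a ℤ^{d+1}`. -/
noncomputable def interpolate {d : ℕ} (T : CubeSubdivision d) (a : ℝ) (u : Pt d → ℝ) (x : Pt d) :
    ℝ :=
  if h : ∃ y, IsInterpolation T a u x y then h.choose else 0

theorem exists_isInterpolation {d : ℕ} (T : CubeSubdivision d) {a : ℝ} (ha : a ≠ 0)
    (u : Pt d → ℝ) (x : Pt d) : ∃ y, IsInterpolation T a u x y := by
  have hx : a⁻¹ • x ∈ T.space := by rw [T.space_eq_univ]; trivial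
  obtain ⟨s, hs, hxs⟩ := Geometry.SimplicialComplex.mem_space_iff.1 hx
  obtain ⟨w, hw0, hw1, hwx⟩ := Finset.mem_convexHull'.1 hxs
  refine ⟨_, s, hs, w, hw0, hw1, ?_, rfl⟩
  have : ∑ v ∈ s, w v • (a • v) = a • ∑ v ∈ s, w v • v := by
    rw [Finset.smul_sum]
    exact Finset.sum_congr rfl fun v _ => smul_comm _ _ _
  rw [this, hwx, smul_inv_smul₀ ha]

theorem isInterpolation_unique {d : ℕ} (T : CubeSubdivision d) {a : ℝ} (ha : a ≠ 0)
    (u : Pt d → ℝ) (x : Pt d) {y y' : ℝ} (h : IsInterpolation T a u x y)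
    (h' : IsInterpolation T a u x y') : y = y' := by
  classical
  have key : ∀ s ∈ T.faces, ∀ w : Pt d → ℝ, ∑ v ∈ s, w v = 1 → ∑ v ∈ s, w v • (a • v) = x →
      ∀ t ⊆ s, ∀ p : Pt d → ℝ, ∑ v ∈ t, p v = 1 → ∑ v ∈ t, p v • v = a⁻¹ • x →
      ∑ v ∈ s, w v * u (a • v) = ∑ v ∈ t, p v * u (a • v) := by
    intro s hs w hw1 hwx t hts p hp1 hpx
    have hwx' : ∑ v ∈ s, w v • v = a⁻¹ • x := by
      rw [← hwx, Finset.smul_sum]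
      refine Finset.sum_congr rfl fun v _ => ?_
      rw [smul_comm (w v) a v, inv_smul_smul₀ ha]
    set q : Pt d → ℝ := fun v => if v ∈ t then p v else 0 with hq
    have hq1 : ∑ v ∈ s, q v = 1 := by
      rw [← hp1, Finset.sum_ite_mem, Finset.inter_eq_right.2 hts]
    have hqx : ∑ v ∈ s, q v • v = a⁻¹ • x := by
      rw [← hpx]
      simp only [hq, ite_smul, zero_smul]
      rw [Finset.sum_ite_mem, Finset.inter_eq_right.2 hts]
    have hwq : ∀ v ∈ s, w v = q v := by
      have hind := T.indep hs
      rw [affineIndependent_iff] at hind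
      intro v hv
      have := hind Finset.univ (fun v => w v - q v)
        (by rw [Finset.sum_coe_sort s (fun v => w v - q v), Finset.sum_sub_distrib, hw1, hq1,
          sub_self])
        (by
          rw [Finset.sum_coe_sort s (fun v => (w v - q v) • v)]
          simp only [sub_smul, Finset.sum_sub_distrib, hwx', hqx, sub_self]) ⟨v, hv⟩
        (Finset.mem_univ _)
      exact sub_eq_zero.1 this
    rw [Finset.sum_congr rfl fun v hv => by rw [hwq v hv]]
    simp only [hq, ite_mul, zero_mul]
    rw [Finset.sum_ite_mem, Finset.inter_eq_right.2 hts]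
  obtain ⟨s, hs, w, hw0, hw1, hwx, rfl⟩ := h
  obtain ⟨s', hs', w', hw0', hw1', hwx', rfl⟩ := h'
  have scale : ∀ (s : Finset (Pt d)) (w : Pt d → ℝ), ∑ v ∈ s, w v • (a • v) = x →
      ∑ v ∈ s, w v • v = a⁻¹ • x := by
    intro s w hwx
    rw [← hwx, Finset.smul_sum]
    refine Finset.sum_congr rfl fun v _ => ?_
    rw [smul_comm (w v) a v, inv_smul_smul₀ ha]
  have hm : a⁻¹ • x ∈ convexHull ℝ (s : Set (Pt d)) :=
    Finset.mem_convexHull'.2 ⟨w, hw0, hw1, scale _ _ hwx⟩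
  have hm' : a⁻¹ • x ∈ convexHull ℝ (s' : Set (Pt d)) :=
    Finset.mem_convexHull'.2 ⟨w', hw0', hw1', scale _ _ hwx'⟩
  have hmem := T.inter_subset_convexHull hs hs' ⟨hm, hm'⟩
  rw [← Finset.coe_inter] at hmem
  obtain ⟨p, -, hp1, hpx⟩ := Finset.mem_convexHull'.1 hmem
  rw [key s hs w hw1 hwx _ Finset.inter_subset_left p hp1 hpx,
    key s' hs' w' hw1' hwx' _ Finset.inter_subset_right p hp1 hpx]

/-- The linear interpolation is well defined: `interpolate` has the value prescribed by any
simplex that contains the point. -/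
theorem interpolate_eq_iff {d : ℕ} (T : CubeSubdivision d) {a : ℝ} (ha : a ≠ 0)
    (u : Pt d → ℝ) (x : Pt d) (y : ℝ) :
    interpolate T a u x = y ↔ IsInterpolation T a u x y := by
  have h := exists_isInterpolation T ha u x
  have hs : IsInterpolation T a u x (interpolate T a u x) := by
    rw [interpolate, dif_pos h]
    exact h.choose_spec
  exact ⟨fun e => e ▸ hs, fun hy => isInterpolation_unique T ha u x hs hy⟩

open Classical in
/-- The values at the grid points prescribed by `g : D_{L,a} → ℝ` and the boundary condition:
`g` on `D_{L,a}`, and `1` resp. `-1` where `x ≥ ⌊L/a⌋ a` resp. `x ≤ -⌊L/a⌋ a`. The remaining grid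
points, where the value is set to `0`, have `y ∉ [0,1]^d` and are not corners of any cube that
meets `D_L`. -/
noncomputable def gridValues {d : ℕ} (L : ℝ) (n : ℕ) (g : latticeDomain d L n → ℝ) (z : Pt d) :
    ℝ :=
  if hz : z ∈ latticeDomain d L n then g ⟨z, hz⟩
  else if ∀ i : Fin d, z i.succ ∈ Set.Icc (0 : ℝ) 1 then
    if (⌊L / mesh n⌋ : ℝ) * mesh n ≤ z 0 then 1
    else if z 0 ≤ -((⌊L / mesh n⌋ : ℝ) * mesh n) then -1
    else 0
  else 0

/-- The piecewise linear function `P g`. Only its restriction to `[-L, L] × [0,1]^d` is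
meaningful. -/
noncomputable def extend {d : ℕ} (T : CubeSubdivision d) (L : ℝ) (n : ℕ)
    (g : latticeDomain d L n → ℝ) : Pt d → ℝ :=
  interpolate T (mesh n) (gridValues L n g)

/-- The space `ℋ^{L,a}` of piecewise linear functions on `[-L, L] × [0,1]^d`. -/
def plSpace {d : ℕ} (T : CubeSubdivision d) (L : ℝ) (n : ℕ) : Set (closedDomain d L → ℝ) :=
  Set.range fun g : latticeDomain d L n → ℝ => (closedDomain d L).domRestrict (extend T L n g)

/-- The dimension `N` of the affine space `ℋ^{L,a}`: the dimension of the linear space spanned by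
differences of its elements. -/
noncomputable def dimPL {d : ℕ} (T : CubeSubdivision d) (L : ℝ) (n : ℕ) : ℕ :=
  Module.finrank ℝ (vectorSpan ℝ (plSpace T L n))

/-- `∫_{D_L} |∇h(z)|² dz`. -/
noncomputable def dirichlet {d : ℕ} (L : ℝ) (h : Pt d → ℝ) : ℝ :=
  ∫ z in domain d L, ‖gradient h z‖ ^ 2

/-- The Gaussian density `exp(-(1/2ε) ∫_{D_L} |∇h|²)` of `ν₁^ε` before normalization, in the
coordinates `(h(z))_{z ∈ D_{L,a}}` of `ℋ^{L,a} ≅ ℝ^N`. -/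
noncomputable def gaussDensity {d : ℕ} (T : CubeSubdivision d) (L : ℝ) (n : ℕ) (ε : ℝ)
    (g : latticeDomain d L n → ℝ) : ℝ≥0∞ :=
  ENNReal.ofReal (Real.exp (-(1 / (2 * ε)) * dirichlet L (extend T L n g)))

/-- The normalization constant `Z₁^ε` of the Gaussian measure, an integral against the Lebesgue
measure on `ℋ^{L,a} ≅ ℝ^N`. -/
noncomputable def Z₁ {d : ℕ} (T : CubeSubdivision d) (L : ℝ) (n : ℕ) (ε : ℝ) : ℝ≥0∞ :=
  ∫⁻ g, gaussDensity T L n ε g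

/-- The discrete Gaussian free field `ν₁^ε` on `ℋ^{L,a} ≅ ℝ^N`. -/
noncomputable def ν₁ {d : ℕ} (T : CubeSubdivision d) (L : ℝ) (n : ℕ) (ε : ℝ) :
    Measure (latticeDomain d L n → ℝ) :=
  (Z₁ T L n ε)⁻¹ • volume.withDensity (gaussDensity T L n ε)

/-- The normalization constant `Z^ε = ∫ exp(-(1/ε) ∫_{D_L} F(h(z)) dz) ν₁^ε(dh)` of the
lattice measure relative to `ν₁^ε`. -/
noncomputable def Z {d : ℕ} (T : CubeSubdivision d) (F : ℝ → ℝ) (L : ℝ) (n : ℕ) (ε : ℝ) : ℝ≥0∞ :=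
  ∫⁻ g, ENNReal.ofReal (Real.exp (-(1 / ε) * ∫ z in domain d L, F (extend T L n g z)))
    ∂(ν₁ T L n ε)

/-- `f(ε) ∼ g(ε)` as `ε ↓ 0`: `f` and `g` are of the same order, that is, `f` lies between two
positive constant multiples of `g` for all small `ε > 0`. -/
def SameOrder (f g : ℝ → ℝ) : Prop :=
  ∃ c > 0, ∃ C > 0, ∀ᶠ ε in 𝓝[>] (0 : ℝ), c * g ε ≤ f ε ∧ f ε ≤ C * g ε

end AllenCahn

/-!
Write `E(h) = ½ ∫ |∇h|² + ∫ F(h)` for the energy on `D_L`. Then `Z^ε` is the quotient of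
`∫ exp(-E(h)/ε) dh` by `Z₁^ε`, and the coordinates of `h` are its `N = |D_{L,a}|` values on the
lattice (`dimPL_eq_card`), which gives the order of `N` by counting. The bound on `Z^ε` is a
statement on exponential scale `1/ε`, and `ε N` is a positive power of `ε`; hence factors of the
form `ε^{kN}` are negligible, and no sharp Gaussian computation is needed.

* Numerator. For every `δ > 0` the solution of `V' = √(2F(V)) + δ`, cut off at `±1`, is a profile
  that moves from `-1` to `1` in finite time with energy at most `C_* + 2δ + 2δ²`
  (`exists_profile`). On a cube, the interpolation of a function `U(x)` of `x` alone is affine in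
  `x`, whatever the subdivision into simplices (`interpolate_profile`), so that the discretized
  profile has nearly the same energy. All simplices are translates of finitely many, thus
  interpolations of values of size `r` are `K r / a`-Lipschitz with `K` independent of the mesh size
  (`CubeSubdivision.exists_interpolate_lipschitz`). For `r = ε` the energy therefore stays below
  `C_* + η` on the whole box of configurations that differ from the profile by at most `r` at
  each lattice point (`exists_low_energy`). The volume `(2ε)^N` of the box is negligible.
* Denominator. Let `M` be the maximum of `|h - 1|` over the lattice, attained at `z`, and suppose
  `M ≥ 2`, so that the boundary value `-1` does not exceed the maximum. By the
  Lipschitz bound `|h - 1| ≥ M / 2` in a neighbourhood of `z` of size comparable to `a`, while `h = 1`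
  at the right end. Integrating `∂ₓh` along the lines in between (Rademacher's theorem and the
  fundamental theorem of calculus for Lipschitz functions) yields
  `∫ |∇h|² ≥ c a^{2d} M² / L` (`exists_dirichlet_coercive`). So `Z₁^ε` is at most a product of `N`
  one-dimensional Gaussian integrals with variance polynomial in `1/ε` (`Z₁_le`).

No measurability of the densities in `h` is used: the numerator is bounded below by constants on a
box, the denominator is bounded above pointwise.
-/

namespace AllenCahn

/-! ### Linear interpolation on the triangulation -/


/-- Barycentric coordinates are Lipschitz on a simplex, because the linear map
`c ↦ (∑ c v, ∑ c v • v)` is injective. -/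
theorem exists_barycentric_bound {d : ℕ} (s : Finset (Pt d))
    (h : AffineIndependent ℝ ((↑) : s → Pt d)) :
    ∃ K : ℝ, 0 ≤ K ∧ ∀ c : Pt d → ℝ, ∑ v ∈ s, c v = 0 →
      ∀ v ∈ s, |c v| ≤ K * ‖∑ v ∈ s, c v • v‖ := by
  classical
  let f : (s → ℝ) →ₗ[ℝ] ℝ × Pt d :=
    { toFun := fun c => (∑ v, c v, ∑ v, c v • (v : Pt d))
      map_add' := fun c c' => by simp [Finset.sum_add_distrib, add_smul]
      map_smul' := fun r c => by simp [Finset.mul_sum, Finset.smul_sum, mul_smul] }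
  have hker : LinearMap.ker f = ⊥ := by
    rw [LinearMap.ker_eq_bot']
    intro c hc
    rw [affineIndependent_iff] at h
    have h1 : ∑ v, c v = 0 := congrArg Prod.fst hc
    have h2 : ∑ v, c v • (v : Pt d) = 0 := congrArg Prod.snd hc
    ext v
    exact h Finset.univ c h1 h2 v (Finset.mem_univ v)
  obtain ⟨K, -, hK⟩ := f.exists_antilipschitzWith hker
  refine ⟨K, K.2, fun c hc v hv => ?_⟩
  have h1 := hK.le_mul_dist (fun v : s => c v) 0
  rw [map_zero, dist_zero_right, dist_zero_right] at h1
  have h2 : ‖f fun v : s => c v‖ = ‖∑ v ∈ s, c v • v‖ := by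
    change ‖((∑ v : s, c v, ∑ v : s, c v • (v : Pt d)) : ℝ × Pt d)‖ = _
    rw [Finset.sum_coe_sort s (fun v => c v), Finset.sum_coe_sort s (fun v => c v • v), hc,
      Prod.norm_def]
    simp
  rw [h2] at h1
  exact (norm_le_pi_norm (fun v : s => c v) ⟨v, hv⟩).trans h1

/-- The `2^{d+1}` corners of the unit cube. -/
noncomputable def unitCorners (d : ℕ) : Finset (Pt d) := by
  classical
  exact Finset.univ.image fun b : Fin (d + 1) → Bool =>
    (WithLp.toLp 2 (fun i => if b i then (1 : ℝ) else 0) : Pt d)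

theorem mem_unitCorners {d : ℕ} {v : Pt d} (h : ∀ i, v i = 0 ∨ v i = 1) : v ∈ unitCorners d := by
  classical
  refine Finset.mem_image.2 ⟨fun i => decide (v i = 1), Finset.mem_univ _, ?_⟩
  ext i
  rcases h i with h | h <;> simp [h]

/-- Barycentric coordinates are Lipschitz on every simplex, with one constant for the whole
triangulation, because there are only finitely many simplices up to translation. -/
theorem CubeSubdivision.exists_barycentric_bound {d : ℕ} (T : CubeSubdivision d) :
    ∃ K : ℝ, 1 ≤ K ∧ ∀ s ∈ T.faces, ∀ c : Pt d → ℝ, ∑ v ∈ s, c v = 0 →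
      ∀ u : Pt d → ℝ, ∀ M, (∀ v ∈ s, |u v| ≤ M) →
        |∑ v ∈ s, c v * u v| ≤ K * M * ‖∑ v ∈ s, c v • v‖ := by
  classical
  have hex : ∀ s : Finset (Pt d), ∃ K : ℝ, 0 ≤ K ∧ (AffineIndependent ℝ ((↑) : s → Pt d) →
      ∀ c : Pt d → ℝ, ∑ v ∈ s, c v = 0 → ∀ v ∈ s, |c v| ≤ K * ‖∑ v ∈ s, c v • v‖) := by
    intro s
    by_cases h : AffineIndependent ℝ ((↑) : s → Pt d)
    · obtain ⟨K, h0, hK⟩ := AllenCahn.exists_barycentric_bound s h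
      exact ⟨K, h0, fun _ => hK⟩
    · exact ⟨0, le_rfl, fun h' => absurd h' h⟩
  choose K hK0 hK using hex
  set P := unitCorners d
  set K₀ := ∑ t ∈ P.powerset, K t with hK₀
  have hK₀0 : 0 ≤ K₀ := Finset.sum_nonneg fun t _ => hK0 t
  refine ⟨1 + P.card * K₀, by have := mul_nonneg (Nat.cast_nonneg (α := ℝ) P.card) hK₀0; linarith,
    ?_⟩
  intro s hs c hc u M hM
  obtain ⟨k, hk⟩ := T.corners s hs
  set p : Pt d := WithLp.toLp 2 (fun i => ((-k i : ℤ) : ℝ)) with hp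
  set t := s.map (addRightEmbedding p) with ht
  have htf : t ∈ T.faces := T.translate s hs (fun i => -k i)
  have htP : t ⊆ P := by
    intro v hv
    obtain ⟨v', hv', rfl⟩ := Finset.mem_map.1 hv
    refine mem_unitCorners fun i => ?_
    rcases hk v' hv' i with h | h
    · left; simp [h, hp]
    · right; simp [h, hp]
  have hsum : ∀ f : Pt d → ℝ, ∑ v ∈ t, f v = ∑ v ∈ s, f (v + p) := fun f => by
    rw [ht, Finset.sum_map]; rfl
  have hsum' : ∀ f : Pt d → Pt d, ∑ v ∈ t, f v = ∑ v ∈ s, f (v + p) := fun f => by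
    rw [ht, Finset.sum_map]; rfl
  have hb : ∀ v ∈ s, |c v| ≤ K₀ * ‖∑ v ∈ s, c v • v‖ := by
    intro v hv
    have h1 := hK t (T.indep htf) (fun v => c (v - p)) (by rw [hsum]; simpa using hc) (v + p)
      (Finset.mem_map_of_mem _ hv)
    rw [hsum'] at h1
    simp only [add_sub_cancel_right, smul_add, Finset.sum_add_distrib, ← Finset.sum_smul, hc,
      zero_smul, add_zero] at h1
    refine h1.trans (mul_le_mul_of_nonneg_right ?_ (norm_nonneg _))
    exact Finset.single_le_sum (f := K) (fun t _ => hK0 t) (Finset.mem_powerset.2 htP)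
  have hcard : (s.card : ℝ) ≤ P.card := by
    have : t.card = s.card := Finset.card_map _
    rw [← this]
    exact_mod_cast Finset.card_le_card htP
  set R := ‖∑ v ∈ s, c v • v‖
  have hR : 0 ≤ R := norm_nonneg _
  have hM0 : 0 ≤ M := by
    obtain ⟨v, hv⟩ := T.nonempty_of_mem_faces hs
    exact (abs_nonneg _).trans (hM v hv)
  calc |∑ v ∈ s, c v * u v| ≤ ∑ v ∈ s, |c v * u v| := Finset.abs_sum_le_sum_abs _ _
    _ ≤ ∑ _v ∈ s, K₀ * R * M := by
        refine Finset.sum_le_sum fun v hv => ?_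
        rw [abs_mul]
        exact mul_le_mul (hb v hv) (hM v hv) (abs_nonneg _) (by positivity)
    _ = s.card * (K₀ * R * M) := by rw [Finset.sum_const, nsmul_eq_mul]
    _ ≤ P.card * (K₀ * R * M) := mul_le_mul_of_nonneg_right hcard (by positivity)
    _ ≤ (1 + P.card * K₀) * M * R := by nlinarith [mul_nonneg hM0 hR]

/-- Points near `p` share a simplex with `p`: only finitely many simplices come near `p`, and
those that do not contain `p` stay away from it. -/
theorem CubeSubdivision.eventually_common_face {d : ℕ} (T : CubeSubdivision d) (p : Pt d) :
    ∀ᶠ p' in 𝓝 p, ∃ s ∈ T.faces, p ∈ convexHull ℝ (s : Set (Pt d)) ∧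
      p' ∈ convexHull ℝ (s : Set (Pt d)) := by
  classical
  -- the integer points near `p`
  set V : Set (Pt d) := {v | ∀ i, ∃ k : ℤ, v i = k ∧ k ∈ Set.Icc ⌊p i - 2⌋ ⌈p i + 2⌉} with hV
  have hVfin : V.Finite := by
    refine ((Set.Finite.pi (t := fun i => Set.Icc ⌊p i - 2⌋ ⌈p i + 2⌉)
      fun i => Set.finite_Icc _ _).image
      (fun k : Fin (d + 1) → ℤ => (WithLp.toLp 2 (fun i => (k i : ℝ)) : Pt d))).subset ?_
    intro v hv
    choose k hk hk' using hv
    refine ⟨k, fun i _ => hk' i, ?_⟩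
    ext i
    simp [hk i]
  set 𝒮 : Set (Finset (Pt d)) := {s | s ∈ T.faces ∧ (s : Set (Pt d)) ⊆ V}
  have h𝒮 : 𝒮.Finite := by
    refine (hVfin.toFinset.powerset.finite_toSet).subset fun s hs => ?_
    simp only [Finset.coe_powerset, Set.Finite.coe_toFinset, Set.mem_preimage, Set.mem_powerset_iff]
    exact hs.2
  have hnear : ∀ᶠ p' in 𝓝 p, ∀ s ∈ 𝒮, p ∉ convexHull ℝ (s : Set (Pt d)) →
      p' ∉ convexHull ℝ (s : Set (Pt d)) := by
    refine (eventually_all_finite h𝒮).2 fun s _ => ?_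
    by_cases hp : p ∈ convexHull ℝ (s : Set (Pt d))
    · exact Eventually.of_forall fun _ h => absurd hp h
    · have hcl : IsClosed (convexHull ℝ (s : Set (Pt d))) :=
        (s.finite_toSet.isCompact_convexHull (𝕜 := ℝ)).isClosed
      filter_upwards [hcl.isOpen_compl.mem_nhds hp] with p' hp' _
      exact hp'
  filter_upwards [hnear, Metric.ball_mem_nhds p one_pos] with p' h1 h2
  have hp' : p' ∈ T.space := by rw [T.space_eq_univ]; trivial
  obtain ⟨s, hs, hps⟩ := Geometry.SimplicialComplex.mem_space_iff.1 hp'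
  refine ⟨s, hs, ?_, hps⟩
  by_contra hcon
  refine h1 s ⟨hs, ?_⟩ hcon hps
  obtain ⟨k, hk⟩ := T.corners s hs
  intro v hv i
  have hbd : p' i ∈ Set.Icc (k i : ℝ) (k i + 1) := by
    have hconv : Convex ℝ {x : Pt d | x i ∈ Set.Icc (k i : ℝ) (k i + 1)} :=
      (convex_Icc (k i : ℝ) (k i + 1)).linear_preimage
        (EuclideanSpace.proj (𝕜 := ℝ) i : Pt d →L[ℝ] ℝ).toLinearMap
    refine convexHull_min ?_ hconv hps
    intro v hv
    rcases hk v hv i with h | h <;> simp [h]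
  have hd : |p' i - p i| < 1 := by
    have h3 := PiLp.norm_apply_le (p' - p) i
    rw [Metric.mem_ball, dist_eq_norm] at h2
    simpa using h3.trans_lt h2
  rw [abs_lt] at hd
  have key : ∀ m : ℤ, m = k i ∨ m = k i + 1 → m ∈ Set.Icc ⌊p i - 2⌋ ⌈p i + 2⌉ := by
    intro m hm
    have hm' : (k i : ℝ) ≤ m ∧ (m : ℝ) ≤ k i + 1 := by
      rcases hm with rfl | rfl <;> push_cast <;> constructor <;> linarith
    constructor
    · have : (⌊p i - 2⌋ : ℝ) ≤ m := (Int.floor_le _).trans (by linarith [hbd.2, hm'.1])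
      exact_mod_cast this
    · have : (m : ℝ) ≤ ⌈p i + 2⌉ := le_trans (by linarith [hbd.1, hm'.2]) (Int.le_ceil _)
      exact_mod_cast this
  rcases hk v hv i with h | h
  · exact ⟨k i, h, key _ (Or.inl rfl)⟩
  · exact ⟨k i + 1, by rw [h]; push_cast; rfl, key _ (Or.inr rfl)⟩

/-- A function that is `K`-Lipschitz at every point, in a neighbourhood depending on the point, is
`K`-Lipschitz. -/
theorem lipschitz_of_eventually {E : Type*} [NormedAddCommGroup E] [NormedSpace ℝ E]
    {f : E → ℝ} {K : ℝ} (h : ∀ x, ∀ᶠ y in 𝓝 x, |f y - f x| ≤ K * ‖y - x‖)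
    (x y : E) : |f y - f x| ≤ K * ‖y - x‖ := by
  have hcont : Continuous f := by
    rw [continuous_iff_continuousAt]
    intro x
    have h0 : Tendsto (fun y => K * ‖y - x‖) (𝓝 x) (𝓝 0) := by
      have : Continuous fun y => K * ‖y - x‖ := by fun_prop
      simpa using this.tendsto x
    exact tendsto_iff_dist_tendsto_zero.2
      (squeeze_zero' (Eventually.of_forall fun _ => dist_nonneg) (h x) h0)
  -- one-sided bound on the segment, then exchange the endpoints
  have key : ∀ x y : E, f y - f x ≤ K * ‖y - x‖ := by
    intro x y
    set γ : ℝ → E := fun t => x + t • (y - x) with hγ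
    have hγc : Continuous γ := by fun_prop
    have := image_le_of_liminf_slope_right_le_deriv_boundary (f := fun t => f (γ t) - f x)
      (a := 0) (b := 1) (B := fun t => t * (K * ‖y - x‖)) (B' := fun _ => K * ‖y - x‖)
      (by fun_prop) (by simp [hγ]) (by fun_prop)
      (fun t _ => by simpa using (hasDerivWithinAt_id t (Set.Ici t)).mul_const (K * ‖y - x‖))
      (by
        intro t _ r hr
        refine Eventually.frequently ?_
        have h1 : ∀ᶠ z in 𝓝[>] t, |f (γ z) - f (γ t)| ≤ K * ‖γ z - γ t‖ :=
          (hγc.tendsto t).mono_left nhdsWithin_le_nhds (h (γ t))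
        filter_upwards [h1, self_mem_nhdsWithin] with z hz hzt
        have hzt' : 0 < z - t := sub_pos.2 hzt
        refine lt_of_le_of_lt ?_ hr
        rw [slope_def_field, div_le_iff₀ hzt']
        have h2 : γ z - γ t = (z - t) • (y - x) := by simp only [hγ]; module
        rw [h2, norm_smul, Real.norm_of_nonneg hzt'.le] at hz
        have := (le_abs_self _).trans hz
        linarith) (Set.right_mem_Icc.2 zero_le_one)
    simpa [hγ] using this
  refine abs_le.2 ⟨?_, key x y⟩
  have := key y x
  rw [norm_sub_rev] at this
  linarith

/-- A choice of simplex and of barycentric coordinates at `x`, which computes all interpolations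
at `x` simultaneously. -/
theorem interpolate_eq_sum {d : ℕ} (T : CubeSubdivision d) {a : ℝ} (ha : a ≠ 0) {s : Finset (Pt d)}
    (hs : s ∈ T.faces) {x : Pt d} (hx : a⁻¹ • x ∈ convexHull ℝ (s : Set (Pt d))) :
    ∃ w : Pt d → ℝ, (∀ v ∈ s, 0 ≤ w v) ∧ ∑ v ∈ s, w v = 1 ∧ ∑ v ∈ s, w v • (a • v) = x ∧
      ∀ u, interpolate T a u x = ∑ v ∈ s, w v * u (a • v) := by
  obtain ⟨w, hw0, hw1, hwx⟩ := Finset.mem_convexHull'.1 hx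
  have hx' : ∑ v ∈ s, w v • (a • v) = x := by
    have : ∑ v ∈ s, w v • (a • v) = a • ∑ v ∈ s, w v • v := by
      rw [Finset.smul_sum]
      exact Finset.sum_congr rfl fun v _ => smul_comm _ _ _
    rw [this, hwx, smul_inv_smul₀ ha]
  exact ⟨w, hw0, hw1, hx', fun u =>
    (interpolate_eq_iff T ha u x _).2 ⟨s, hs, w, hw0, hw1, hx', rfl⟩⟩

theorem exists_interpolate_eq_sum {d : ℕ} (T : CubeSubdivision d) {a : ℝ} (ha : a ≠ 0) (x : Pt d) :
    ∃ s ∈ T.faces, ∃ w : Pt d → ℝ, (∀ v ∈ s, 0 ≤ w v) ∧ ∑ v ∈ s, w v = 1 ∧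
      ∑ v ∈ s, w v • (a • v) = x ∧ ∀ u, interpolate T a u x = ∑ v ∈ s, w v * u (a • v) := by
  have hx : a⁻¹ • x ∈ T.space := by rw [T.space_eq_univ]; trivial
  obtain ⟨s, hs, hxs⟩ := Geometry.SimplicialComplex.mem_space_iff.1 hx
  exact ⟨s, hs, interpolate_eq_sum T ha hs hxs⟩

theorem interpolate_add {d : ℕ} (T : CubeSubdivision d) {a : ℝ} (ha : a ≠ 0) (u u' : Pt d → ℝ)
    (x : Pt d) :
    interpolate T a (fun z => u z + u' z) x = interpolate T a u x + interpolate T a u' x := by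
  obtain ⟨s, -, w, -, -, -, h⟩ := exists_interpolate_eq_sum T ha x
  simp only [h, mul_add, Finset.sum_add_distrib]

theorem interpolate_smul {d : ℕ} (T : CubeSubdivision d) {a : ℝ} (ha : a ≠ 0) (c : ℝ)
    (u : Pt d → ℝ) (x : Pt d) :
    interpolate T a (fun z => c * u z) x = c * interpolate T a u x := by
  obtain ⟨s, -, w, -, -, -, h⟩ := exists_interpolate_eq_sum T ha x
  simp only [h, Finset.mul_sum]
  exact Finset.sum_congr rfl fun v _ => by ring

theorem interpolate_const {d : ℕ} (T : CubeSubdivision d) {a : ℝ} (ha : a ≠ 0) (c : ℝ)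
    (x : Pt d) : interpolate T a (fun _ => c) x = c := by
  obtain ⟨s, -, w, -, h1, -, h⟩ := exists_interpolate_eq_sum T ha x
  rw [h, ← Finset.sum_mul, h1, one_mul]

theorem abs_interpolate_le {d : ℕ} (T : CubeSubdivision d) {a : ℝ} (ha : a ≠ 0) {u : Pt d → ℝ}
    {M : ℝ} (hu : ∀ z, |u z| ≤ M) (x : Pt d) : |interpolate T a u x| ≤ M := by
  obtain ⟨s, -, w, h0, h1, -, h⟩ := exists_interpolate_eq_sum T ha x
  rw [h]
  calc |∑ v ∈ s, w v * u (a • v)| ≤ ∑ v ∈ s, |w v * u (a • v)| := Finset.abs_sum_le_sum_abs _ _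
    _ ≤ ∑ v ∈ s, w v * M := Finset.sum_le_sum fun v hv => by
        rw [abs_mul, abs_of_nonneg (h0 v hv)]
        exact mul_le_mul_of_nonneg_left (hu _) (h0 v hv)
    _ = M := by rw [← Finset.sum_mul, h1, one_mul]

/-- Interpolations of bounded grid values are Lipschitz. -/
theorem CubeSubdivision.exists_interpolate_lipschitz {d : ℕ} (T : CubeSubdivision d) :
    ∃ K : ℝ, 1 ≤ K ∧ ∀ a : ℝ, 0 < a → ∀ (u : Pt d → ℝ) (M : ℝ), (∀ z, |u z| ≤ M) →
      ∀ x y, |interpolate T a u y - interpolate T a u x| ≤ K * M / a * ‖y - x‖ := by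
  obtain ⟨K, hK1, hK⟩ := T.exists_barycentric_bound
  refine ⟨K, hK1, fun a ha u M hM => lipschitz_of_eventually fun x => ?_⟩
  have hcont : Continuous fun y : Pt d => a⁻¹ • y := continuous_const_smul _
  filter_upwards [(hcont.tendsto x) (T.eventually_common_face (a⁻¹ • x))] with y hy
  obtain ⟨s, hs, hx, hy⟩ := hy
  obtain ⟨w, -, hw1, hwx, hw⟩ := interpolate_eq_sum T ha.ne' hs hx
  obtain ⟨w', -, hw1', hwy, hw'⟩ := interpolate_eq_sum T ha.ne' hs hy
  have h := hK s hs (fun v => w' v - w v) (by rw [Finset.sum_sub_distrib, hw1, hw1', sub_self])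
    (fun v => u (a • v)) M (fun v _ => hM _)
  have e1 : ∑ v ∈ s, (w' v - w v) * u (a • v) = interpolate T a u y - interpolate T a u x := by
    rw [hw, hw', ← Finset.sum_sub_distrib]
    exact Finset.sum_congr rfl fun v _ => by ring
  have e2 : y - x = a • ∑ v ∈ s, (w' v - w v) • v := by
    rw [← hwx, ← hwy, ← Finset.sum_sub_distrib, Finset.smul_sum]
    refine Finset.sum_congr rfl fun v _ => ?_
    module
  rw [e1] at h
  rw [e2, norm_smul, Real.norm_of_nonneg ha.le]
  refine h.trans (le_of_eq ?_)
  field_simp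

theorem weighted_sum_mem_Icc {ι : Type*} {s : Finset ι} {w f : ι → ℝ} {A B : ℝ}
    (hw0 : ∀ v ∈ s, 0 ≤ w v) (hw1 : ∑ v ∈ s, w v = 1) (hf : ∀ v ∈ s, f v ∈ Set.Icc A B) :
    ∑ v ∈ s, w v * f v ∈ Set.Icc A B := by
  have h := (convex_Icc A B).sum_mem hw0 hw1 hf
  simpa only [smul_eq_mul] using h

/-- If a coordinate of a point of a simplex is an integer, then only vertices with the same
coordinate contribute to the point. -/
theorem coord_eq_of_weight_ne_zero {ι : Type*} {s : Finset ι} {w : ι → ℝ} {f : ι → ℝ} {k m : ℤ}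
    (hw0 : ∀ v ∈ s, 0 ≤ w v) (hw1 : ∑ v ∈ s, w v = 1) (hf : ∀ v ∈ s, f v = k ∨ f v = k + 1)
    (hm : ∑ v ∈ s, w v * f v = m) {v : ι} (hv : v ∈ s) (hwv : w v ≠ 0) : f v = m := by
  have hlo : (k : ℝ) ≤ m := by
    rw [← hm]
    refine (weighted_sum_mem_Icc (f := f) (A := k) (B := k + 1) hw0 hw1 fun v hv => ?_).1
    rcases hf v hv with h | h <;> rw [h] <;> simp
  have hhi : (m : ℝ) ≤ k + 1 := by
    rw [← hm]
    refine (weighted_sum_mem_Icc (f := f) (A := k) (B := k + 1) hw0 hw1 fun v hv => ?_).2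
    rcases hf v hv with h | h <;> rw [h] <;> simp
  have hmk : m = k ∨ m = k + 1 := by
    have h1 : k ≤ m := by exact_mod_cast hlo
    have h2 : m ≤ k + 1 := by exact_mod_cast hhi
    omega
  have hsum : ∑ v ∈ s, w v * (f v - m) = 0 := by
    simp only [mul_sub, Finset.sum_sub_distrib, hm, ← Finset.sum_mul, hw1, one_mul, sub_self]
  rcases hmk with h | h
  · have := (Finset.sum_eq_zero_iff_of_nonneg fun v hv => mul_nonneg (hw0 v hv) ?_).1 hsum v hv
    · linarith [(mul_eq_zero.1 this).resolve_left hwv]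
    · rcases hf v hv with h' | h' <;> rw [h', h] <;> simp
  · have hsum' : ∑ v ∈ s, w v * (m - f v) = 0 := by
      rw [← neg_eq_zero, ← Finset.sum_neg_distrib, ← hsum]
      exact Finset.sum_congr rfl fun v _ => by ring
    have := (Finset.sum_eq_zero_iff_of_nonneg fun v hv => mul_nonneg (hw0 v hv) ?_).1 hsum' v hv
    · linarith [(mul_eq_zero.1 this).resolve_left hwv]
    · rcases hf v hv with h' | h' <;> rw [h', h] <;> push_cast <;> simp

/-- The interpolation at `x` only sees grid points `a • v` with `v` integral, in a unit cube that
contains `a⁻¹ • x`, and on the same grid hyperplanes as `x`. -/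
theorem exists_local_representation {d : ℕ} (T : CubeSubdivision d) {a : ℝ} (ha : 0 < a)
    (x : Pt d) :
    ∃ (s : Finset (Pt d)) (w : Pt d → ℝ) (k : Fin (d + 1) → ℤ),
      (∀ v ∈ s, 0 ≤ w v) ∧ ∑ v ∈ s, w v = 1 ∧
      (∀ u, interpolate T a u x = ∑ v ∈ s, w v * u (a • v)) ∧
      (∀ i, a * k i ≤ x i ∧ x i ≤ a * (k i + 1)) ∧
      (∀ v ∈ s, ∀ i, v i = k i ∨ v i = k i + 1) ∧
      (∀ i (m : ℤ), x i = a * m → ∀ v ∈ s, w v ≠ 0 → v i = m) := by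
  obtain ⟨s, hs, w, hw0, hw1, hwx, hw⟩ := exists_interpolate_eq_sum T ha.ne' x
  obtain ⟨k, hk⟩ := T.corners s hs
  have hco : ∀ i, x i = a * ∑ v ∈ s, w v * v i := by
    intro i
    rw [← hwx, Finset.mul_sum]
    simp only [WithLp.ofLp_sum, Finset.sum_apply, PiLp.smul_apply, smul_eq_mul]
    exact Finset.sum_congr rfl fun v _ => by ring
  refine ⟨s, w, k, hw0, hw1, hw, fun i => ?_, hk, fun i m hm v hv hwv => ?_⟩
  · have h := weighted_sum_mem_Icc (f := fun v : Pt d => v i) (A := k i) (B := k i + 1) hw0 hw1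
      fun v hv => by rcases hk v hv i with h | h <;> rw [h] <;> simp
    rw [hco i]
    exact ⟨mul_le_mul_of_nonneg_left h.1 ha.le, mul_le_mul_of_nonneg_left h.2 ha.le⟩
  · refine coord_eq_of_weight_ne_zero hw0 hw1 (fun v hv => hk v hv i) ?_ hv hwv
    have := hco i
    rw [hm] at this
    exact (mul_left_cancel₀ ha.ne' this).symm

theorem interpolate_grid {d : ℕ} (T : CubeSubdivision d) {a : ℝ} (ha : 0 < a) (u : Pt d → ℝ)
    {x : Pt d} (hx : ∀ i, ∃ k : ℤ, x i = a * k) : interpolate T a u x = u x := by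
  obtain ⟨s, w, -, -, hw1, hw, -, -, hm⟩ := exists_local_representation T ha x
  choose m hxm using hx
  rw [hw, ← one_mul (u x), ← hw1, Finset.sum_mul]
  refine Finset.sum_congr rfl fun v hv => ?_
  rcases eq_or_ne (w v) 0 with h | h
  · simp [h]
  · congr 2
    ext i
    rw [PiLp.smul_apply, hm i (m i) (hxm i) v hv h, hxm i, smul_eq_mul]

/-! ### The one-dimensional transition profile -/


/-- The retraction of `ℝ` onto `[-1, 1]`. -/
def clip (u : ℝ) : ℝ := max (-1) (min 1 u)

theorem abs_clip_le (u : ℝ) : |clip u| ≤ 1 :=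
  abs_le.2 ⟨le_max_left _ _, max_le (by norm_num) (min_le_left _ _)⟩

theorem clip_of_one_le {u : ℝ} (h : 1 ≤ u) : clip u = 1 := by
  rw [clip, min_eq_left h]; norm_num

theorem clip_of_le_neg_one {u : ℝ} (h : u ≤ -1) : clip u = -1 := by
  rw [clip, min_eq_right (by linarith), max_eq_left h]

theorem clip_of_mem {u : ℝ} (h : u ∈ Set.Icc (-1 : ℝ) 1) : clip u = u := by
  rw [clip, min_eq_right h.2, max_eq_right h.1]

theorem continuous_clip : Continuous clip := by unfold clip; fun_prop

theorem abs_clip_sub_clip_le (u v : ℝ) : |clip u - clip v| ≤ |u - v| := by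
  unfold clip
  have h1 := abs_max_sub_max_le_max (-1) (min 1 u) (-1) (min 1 v)
  have h2 := abs_min_sub_min_le_max 1 u 1 v
  simp only [sub_self, abs_zero] at h1 h2
  rw [max_eq_right (abs_nonneg (min 1 u - min 1 v))] at h1
  rw [max_eq_right (abs_nonneg (u - v))] at h2
  exact h1.trans h2

/-- The speed `√(2F) + δ` of the transition profile, with `F` frozen outside `[-1, 1]`. The
shift `δ` makes the profile reach `±1` in finite time. -/
noncomputable def speed (F : ℝ → ℝ) (δ : ℝ) (u : ℝ) : ℝ := Real.sqrt (2 * F (clip u)) + δ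

section Profile

variable {F : ℝ → ℝ} {δ : ℝ}

theorem IsDoubleWell.continuous (hF : IsDoubleWell F) : Continuous F := hF.contDiff.continuous

theorem speed_pos (hδ : 0 < δ) (u : ℝ) : 0 < speed F δ u := by
  have := Real.sqrt_nonneg (2 * F (clip u))
  unfold speed; linarith

theorem continuous_speed (hF : IsDoubleWell F) : Continuous (speed F δ) := by
  have := hF.continuous
  have := continuous_clip
  unfold speed
  fun_prop

theorem speed_eq_of_one_le (hF : IsDoubleWell F) {u : ℝ} (h : 1 ≤ u) : speed F δ u = δ := by
  rw [speed, clip_of_one_le h, (hF.eq_zero_iff 1).2 (Or.inl rfl)]; simp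

theorem speed_eq_of_le_neg_one (hF : IsDoubleWell F) {u : ℝ} (h : u ≤ -1) : speed F δ u = δ := by
  rw [speed, clip_of_le_neg_one h, (hF.eq_zero_iff (-1)).2 (Or.inr rfl)]; simp

theorem exists_speed_le (hF : IsDoubleWell F) : ∃ S : ℝ, ∀ u, speed F δ u ≤ S := by
  obtain ⟨S, hS⟩ := (isCompact_Icc (a := (-1 : ℝ)) (b := 1)).exists_bound_of_continuousOn
    (continuous_speed (δ := δ) hF).continuousOn
  refine ⟨S, fun u => ?_⟩
  have h := hS (clip u) (abs_le.1 (abs_clip_le u))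
  have e : speed F δ (clip u) = speed F δ u := by
    rw [speed, clip_of_mem (abs_le.1 (abs_clip_le u))]; rfl
  rw [e] at h
  exact (le_abs_self _).trans h

theorem uniformContinuous_speed (hF : IsDoubleWell F) : UniformContinuous (speed F δ) := by
  have h1 : UniformContinuous fun u : Set.Icc (-1 : ℝ) 1 => speed F δ u :=
    CompactSpace.uniformContinuous_of_continuous
      ((continuous_speed hF).comp continuous_subtype_val)
  have h2 : UniformContinuous (Set.projIcc (-1 : ℝ) 1 (by norm_num)) :=
    (LipschitzWith.projIcc _).uniformContinuous
  have h3 := h1.comp h2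
  convert h3 using 1
  funext u
  simp only [Function.comp_apply, Set.coe_projIcc]
  change _ = speed F δ (clip u)
  rw [speed, speed, clip_of_mem (abs_le.1 (abs_clip_le u))]

/-- The integral of the speed between the points reached one unit of time before and after the
transition. -/
theorem integral_speed (hF : IsDoubleWell F) (hδ : 0 < δ) :
    ∫ u in (-1 - δ)..(1 + δ), speed F δ u = Cstar F + 2 * δ + 2 * δ ^ 2 := by
  have hi : ∀ a b, IntervalIntegrable (speed F δ) volume a b :=
    fun a b => (continuous_speed hF).intervalIntegrable a b
  rw [← intervalIntegral.integral_add_adjacent_intervals (hi (-1 - δ) (-1)) (hi (-1) (1 + δ)),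
    ← intervalIntegral.integral_add_adjacent_intervals (hi (-1) 1) (hi 1 (1 + δ))]
  have h1 : ∫ u in (-1 - δ)..(-1), speed F δ u = ∫ _u in (-1 - δ)..(-1), δ := by
    refine intervalIntegral.integral_congr fun u hu => ?_
    rw [Set.uIcc_of_le (by linarith)] at hu
    exact speed_eq_of_le_neg_one hF hu.2
  have h2 : ∫ u in (1 : ℝ)..(1 + δ), speed F δ u = ∫ _u in (1 : ℝ)..(1 + δ), δ := by
    refine intervalIntegral.integral_congr fun u hu => ?_
    rw [Set.uIcc_of_le (by linarith)] at hu
    exact speed_eq_of_one_le hF hu.1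
  have h3 : ∫ u in (-1 : ℝ)..1, speed F δ u = ∫ u in (-1 : ℝ)..1, (Real.sqrt (2 * F u) + δ) := by
    refine intervalIntegral.integral_congr fun u hu => ?_
    rw [Set.uIcc_of_le (by linarith)] at hu
    simp only [speed, clip_of_mem hu]
  rw [h1, h2, h3, intervalIntegral.integral_add]
  · simp only [intervalIntegral.integral_const, smul_eq_mul, Cstar]
    ring
  · have := hF.continuous
    exact Continuous.intervalIntegrable (by fun_prop) _ _
  · exact intervalIntegrable_const

/-- The solution of `V' = √(2F(V)) + δ`, the inverse function of `u ↦ ∫₀ᵘ dv / (√(2F(v)) + δ)`. -/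
theorem exists_flow (hF : IsDoubleWell F) (hδ : 0 < δ) :
    ∃ V : ℝ → ℝ, Monotone V ∧ (∀ x, HasDerivAt V (speed F δ (V x)) x) ∧
      ∃ A B : ℝ, A < B ∧ V A = -1 ∧ V B = 1 ∧ V (A - 1) = -1 - δ ∧ V (B + 1) = 1 + δ := by
  obtain ⟨S, hS⟩ := exists_speed_le (δ := δ) hF
  have hpos := speed_pos (F := F) hδ
  have hS0 : 0 < S := (hpos 0).trans_le (hS 0)
  have hc : Continuous fun u => (speed F δ u)⁻¹ :=
    (continuous_speed hF).inv₀ fun u => (hpos u).ne'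
  set G : ℝ → ℝ := fun u => ∫ v in (0 : ℝ)..u, (speed F δ v)⁻¹ with hG
  have hGd : ∀ u, HasDerivAt G (speed F δ u)⁻¹ u := fun u =>
    (hc.integral_hasStrictDerivAt 0 u).hasDerivAt
  have hGmono : StrictMono G := strictMono_of_deriv_pos fun u => by
    rw [(hGd u).deriv]; exact inv_pos.2 (hpos u)
  have hGc : Continuous G := continuous_iff_continuousAt.2 fun u => (hGd u).continuousAt
  have hmono : Monotone fun u => G u - S⁻¹ * u := by
    refine monotone_of_deriv_nonneg (fun u => ?_) fun u => ?_
    · exact ((hGd u).sub ((hasDerivAt_id u).const_mul S⁻¹)).differentiableAt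
    · have := ((hGd u).sub ((hasDerivAt_id u).const_mul S⁻¹)).deriv
      refine le_of_le_of_eq ?_ this.symm
      rw [mul_one, sub_nonneg]
      exact inv_anti₀ (hpos u) (hS u)
  have hG0 : G 0 = 0 := by simp [hG]
  have hsurj : Function.Surjective G := by
    refine hGc.surjective ?_ ?_
    · refine tendsto_atTop_mono' atTop ?_ (tendsto_id.const_mul_atTop (inv_pos.2 hS0))
      filter_upwards [eventually_ge_atTop 0] with u hu
      have := hmono hu
      simp only [hG0, mul_zero, sub_zero] at this
      simp only [id]
      linarith
    · refine tendsto_atBot_mono' atBot ?_ (tendsto_id.const_mul_atBot (inv_pos.2 hS0))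
      filter_upwards [eventually_le_atBot 0] with u hu
      have := hmono hu
      simp only [hG0, mul_zero, sub_zero] at this
      simp only [id]
      linarith
  set e := hGmono.orderIsoOfSurjective G hsurj with he
  have heG : ∀ u, e u = G u := fun u => rfl
  have hVG : ∀ u, e.symm (G u) = u := fun u => by rw [← heG, e.symm_apply_apply]
  have hadj : ∀ a b, G b - G a = ∫ v in a..b, (speed F δ v)⁻¹ := fun a b =>
    intervalIntegral.integral_interval_sub_left (hc.intervalIntegrable _ _)
      (hc.intervalIntegrable _ _)
  refine ⟨e.symm, e.symm.monotone, fun x => ?_, G (-1), G 1, hGmono (by norm_num), hVG _, hVG _,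
    ?_, ?_⟩
  · have := HasDerivAt.of_local_left_inverse (f := G) (g := e.symm) (a := x)
      e.symm.continuous.continuousAt (hGd (e.symm x)) (inv_ne_zero (hpos _).ne')
      (Eventually.of_forall fun y => by rw [← heG, e.apply_symm_apply])
    rwa [inv_inv] at this
  · have h : G (-1) - G (-1 - δ) = 1 := by
      rw [hadj, intervalIntegral.integral_congr (g := fun _ => δ⁻¹) fun u hu => ?_]
      · rw [intervalIntegral.integral_const]; simp [hδ.ne']
      · rw [Set.uIcc_of_le (by linarith)] at hu
        simp only [speed_eq_of_le_neg_one hF hu.2]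
    rw [show G (-1) - 1 = G (-1 - δ) by linarith, hVG]
  · have h : G (1 + δ) - G 1 = 1 := by
      rw [hadj, intervalIntegral.integral_congr (g := fun _ => δ⁻¹) fun u hu => ?_]
      · rw [intervalIntegral.integral_const]; simp [hδ.ne']
      · rw [Set.uIcc_of_le (by linarith)] at hu
        simp only [speed_eq_of_one_le hF hu.1]
    rw [show G 1 + 1 = G (1 + δ) by linarith, hVG]

/-- A transition profile `U` from `-1` to `1` whose energy is close to `C_*`. The function `s`
controls the slopes of `U`; on `[A, B]`, where the transition takes place, it is the derivative. -/
theorem exists_profile (hF : IsDoubleWell F) (hδ : 0 < δ) :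
    ∃ (U s : ℝ → ℝ) (A B S : ℝ), A < B ∧ Continuous U ∧ (∀ x, |U x| ≤ 1) ∧
      (∀ x ≤ A, U x = -1) ∧ (∀ x, B ≤ x → U x = 1) ∧
      UniformContinuous s ∧ (∀ x, 0 ≤ s x) ∧ (∀ x, s x ≤ S) ∧
      (∀ x y, x < y → ∃ ξ ∈ Set.Icc x y, |U y - U x| ≤ s ξ * (y - x)) ∧
      ∫ x in (A - 1)..(B + 1), (1 / 2 * s x ^ 2 + F (U x)) ≤ Cstar F + 2 * δ + 2 * δ ^ 2 := by
  obtain ⟨V, hVm, hV, A, B, hAB, hVA, hVB, hVA', hVB'⟩ := exists_flow hF hδ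
  obtain ⟨S, hS⟩ := exists_speed_le (δ := δ) hF
  have hpos := speed_pos (F := F) hδ
  have hVc : Continuous V := continuous_iff_continuousAt.2 fun x => (hV x).continuousAt
  have hVL : LipschitzWith S.toNNReal V := lipschitzWith_of_nnnorm_deriv_le
    (fun x => (hV x).differentiableAt) fun x => by
      rw [(hV x).deriv, ← NNReal.coe_le_coe, coe_nnnorm, Real.norm_of_nonneg (hpos _).le]
      exact (hS _).trans (Real.le_coe_toNNReal S)
  have hsc : Continuous fun x => speed F δ (V x) := (continuous_speed hF).comp hVc
  have hUc : Continuous fun x => clip (V x) := continuous_clip.comp hVc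
  have hFc := hF.continuous
  refine ⟨fun x => clip (V x), fun x => speed F δ (V x), A, B, S, hAB, hUc,
    fun x => abs_clip_le _, fun x hx => clip_of_le_neg_one (hVA ▸ hVm hx),
    fun x hx => clip_of_one_le (hVB ▸ hVm hx), (uniformContinuous_speed hF).comp
    hVL.uniformContinuous, fun x => (hpos _).le, fun x => hS _, fun x y hxy => ?_, ?_⟩
  · obtain ⟨ξ, hξ, h⟩ := exists_hasDerivAt_eq_slope V (fun x => speed F δ (V x)) hxy
      hVc.continuousOn fun x _ => hV x
    refine ⟨ξ, Set.Ioo_subset_Icc_self hξ, (abs_clip_sub_clip_le _ _).trans ?_⟩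
    simp only [h]
    rw [div_mul_cancel₀ _ (sub_pos.2 hxy).ne', abs_of_nonneg (sub_nonneg.2 (hVm hxy.le))]
  · calc ∫ x in (A - 1)..(B + 1), (1 / 2 * speed F δ (V x) ^ 2 + F (clip (V x)))
        ≤ ∫ x in (A - 1)..(B + 1), (speed F δ ∘ V) x * speed F δ (V x) := by
          refine intervalIntegral.integral_mono_on (by linarith)
            (Continuous.intervalIntegrable (by fun_prop) _ _)
            (Continuous.intervalIntegrable (hsc.mul hsc) _ _) fun x _ => ?_
          -- `½ q² + ½ (q - δ)² ≤ q²` for the speed `q`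
          have h0 := hF.nonneg (clip (V x))
          have h1 : speed F δ (V x) = Real.sqrt (2 * F (clip (V x))) + δ := rfl
          have h2 := Real.sq_sqrt (show 0 ≤ 2 * F (clip (V x)) by linarith)
          have h3 := Real.sqrt_nonneg (2 * F (clip (V x)))
          simp only [Function.comp_apply]
          nlinarith
      _ = ∫ u in (V (A - 1))..(V (B + 1)), speed F δ u :=
          intervalIntegral.integral_comp_mul_deriv (fun x _ => hV x) hsc.continuousOn
            (continuous_speed hF)
      _ = Cstar F + 2 * δ + 2 * δ ^ 2 := by rw [hVA', hVB', integral_speed hF hδ]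

end Profile

/-! ### Grid values, coordinates and lines in the `x`-direction -/


theorem mesh_pos {n : ℕ} (hn : 0 < n) : 0 < mesh n := by
  have : (0 : ℝ) < n := by exact_mod_cast hn
  unfold mesh; positivity

theorem mul_mesh {n : ℕ} (hn : 0 < n) : (n : ℝ) * mesh n = 1 := by
  have : (0 : ℝ) < n := by exact_mod_cast hn
  unfold mesh; field_simp

theorem mesh_le_one {n : ℕ} (hn : 0 < n) : mesh n ≤ 1 := by
  have : (1 : ℝ) ≤ n := by exact_mod_cast hn
  unfold mesh
  rw [div_le_one (by linarith)]
  exact this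

/-- Cubes of the grid that meet the slab `{y ∈ (0,1)^d}` have all corners in the closed slab,
because `1/a` is an integer. -/
theorem mesh_mul_mem_Icc {n : ℕ} (hn : 0 < n) {y v : ℝ} {k : ℤ} (hy : y ∈ Set.Ioo (0 : ℝ) 1)
    (h1 : mesh n * k ≤ y) (h2 : y ≤ mesh n * (k + 1)) (hv : v = k ∨ v = k + 1) :
    mesh n * v ∈ Set.Icc (0 : ℝ) 1 := by
  have ha := mesh_pos hn
  have hna := mul_mesh hn
  have hk0 : (0 : ℝ) ≤ k := by
    have : (0 : ℝ) < k + 1 := pos_of_mul_pos_right (hy.1.trans_le h2) ha.le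
    have : (-1 : ℤ) < k := by
      have : (-1 : ℝ) < k := by linarith
      exact_mod_cast this
    exact_mod_cast (by omega : (0 : ℤ) ≤ k)
  have hkn : (k : ℝ) + 1 ≤ n := by
    have : (k : ℝ) < n := by
      by_contra hcon
      push Not at hcon
      have := mul_le_mul_of_nonneg_left hcon ha.le
      linarith [hy.2]
    have : k < (n : ℤ) := by exact_mod_cast this
    exact_mod_cast (by omega : k + 1 ≤ (n : ℤ))
  have hv' : 0 ≤ v ∧ v ≤ n := by rcases hv with rfl | rfl <;> constructor <;> linarith
  exact ⟨mul_nonneg ha.le hv'.1, by nlinarith [mul_le_mul_of_nonneg_left hv'.2 ha.le]⟩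

section GridValues

variable {d : ℕ} {L : ℝ} {n : ℕ}

theorem gridValues_of_mem (g : latticeDomain d L n → ℝ) {z : Pt d} (hz : z ∈ latticeDomain d L n) :
    gridValues L n g z = g ⟨z, hz⟩ := by
  rw [gridValues, dif_pos hz]

theorem sub_mesh_lt_floor (hn : 0 < n) : L - mesh n < (⌊L / mesh n⌋ : ℝ) * mesh n := by
  have ha := mesh_pos hn
  have h := Int.lt_floor_add_one (L / mesh n)
  rw [div_lt_iff₀ ha] at h
  linarith

theorem floor_mul_mesh_le (hn : 0 < n) : (⌊L / mesh n⌋ : ℝ) * mesh n ≤ L := by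
  have ha := mesh_pos hn
  exact (le_div_iff₀ ha).1 (Int.floor_le (L / mesh n))

theorem gridValues_right (hn : 0 < n) (g : latticeDomain d L n → ℝ) {z : Pt d}
    (hy : ∀ i : Fin d, z i.succ ∈ Set.Icc (0 : ℝ) 1)
    (hx : (⌊L / mesh n⌋ : ℝ) * mesh n ≤ z 0) : gridValues L n g z = 1 := by
  have hz : z ∉ latticeDomain d L n := fun hz => by
    have := hz.1.1.2
    linarith [sub_mesh_lt_floor (L := L) hn]
  rw [gridValues, dif_neg hz, if_pos hy, if_pos hx]

theorem gridValues_left (hn : 0 < n) (hL : mesh n ≤ L) (g : latticeDomain d L n → ℝ) {z : Pt d}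
    (hy : ∀ i : Fin d, z i.succ ∈ Set.Icc (0 : ℝ) 1)
    (hx : z 0 ≤ -((⌊L / mesh n⌋ : ℝ) * mesh n)) : gridValues L n g z = -1 := by
  have hlt := sub_mesh_lt_floor (L := L) hn
  have hz : z ∉ latticeDomain d L n := fun hz => by
    have := hz.1.1.1
    linarith
  rw [gridValues, dif_neg hz, if_pos hy, if_neg (by linarith), if_pos hx]

theorem abs_gridValues_sub_one_le (g : latticeDomain d L n → ℝ) {M : ℝ} (hM : 2 ≤ M)
    (hg : ∀ z, |g z - 1| ≤ M) (z : Pt d) : |gridValues L n g z - 1| ≤ M := by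
  unfold gridValues
  split_ifs with h1
  · exact hg _
  all_goals norm_num
  all_goals linarith

/-- Grid points in the slab are in the lattice domain or in the region of boundary values. -/
theorem grid_trichotomy (hn : 0 < n) {z : Pt d} (hz : ∀ i, ∃ k : ℤ, z i = mesh n * k)
    (hy : ∀ i : Fin d, z i.succ ∈ Set.Icc (0 : ℝ) 1) :
    z ∈ latticeDomain d L n ∨ (⌊L / mesh n⌋ : ℝ) * mesh n ≤ z 0 ∨
      z 0 ≤ -((⌊L / mesh n⌋ : ℝ) * mesh n) := by
  have ha := mesh_pos hn
  by_contra hcon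
  push Not at hcon
  obtain ⟨h0, h1, h2⟩ := hcon
  refine h0 ⟨⟨?_, hy⟩, hz⟩
  obtain ⟨k, hk⟩ := hz 0
  have hfl := floor_mul_mesh_le (L := L) hn
  have e1 : (k : ℝ) + 1 ≤ ⌊L / mesh n⌋ := by
    have : (k : ℝ) < ⌊L / mesh n⌋ := by
      rw [hk] at h1
      exact lt_of_mul_lt_mul_left (by linarith : mesh n * (k : ℝ) < mesh n * ⌊L / mesh n⌋) ha.le
    have : k < ⌊L / mesh n⌋ := by exact_mod_cast this
    exact_mod_cast (by omega : k + 1 ≤ ⌊L / mesh n⌋)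
  have e2 : -(⌊L / mesh n⌋ : ℝ) + 1 ≤ k := by
    have : -(⌊L / mesh n⌋ : ℝ) < k := by
      rw [hk] at h2
      exact lt_of_mul_lt_mul_left (by linarith : mesh n * -(⌊L / mesh n⌋ : ℝ) < mesh n * k) ha.le
    have : -⌊L / mesh n⌋ < k := by exact_mod_cast this
    exact_mod_cast (by omega : -⌊L / mesh n⌋ + 1 ≤ k)
  rw [hk]
  constructor <;> nlinarith

end GridValues

/-- The point `(x, y)`. -/
noncomputable def mkPt {d : ℕ} (y : Fin d → ℝ) (x : ℝ) : Pt d := WithLp.toLp 2 (Fin.cons x y)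

@[simp] theorem mkPt_zero {d : ℕ} (y : Fin d → ℝ) (x : ℝ) : mkPt y x 0 = x := rfl

@[simp] theorem mkPt_succ {d : ℕ} (y : Fin d → ℝ) (x : ℝ) (i : Fin d) : mkPt y x i.succ = y i := rfl

theorem mkPt_sub_mkPt {d : ℕ} (y : Fin d → ℝ) (x x' : ℝ) :
    mkPt y x' - mkPt y x = EuclideanSpace.single 0 (x' - x) := by
  ext i
  refine Fin.cases ?_ (fun j => ?_) i <;> simp

/-- The splitting `(x, y) ↦ (y, x)` of `ℝ^{d+1}` as `ℝ^d × ℝ`. -/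
noncomputable def splitEquiv (d : ℕ) : Pt d ≃ᵐ (Fin d → ℝ) × ℝ :=
  ((MeasurableEquiv.toLp 2 (Fin (d + 1) → ℝ)).symm.trans
    (MeasurableEquiv.piFinSuccAbove (fun _ => ℝ) 0)).trans MeasurableEquiv.prodComm

theorem splitEquiv_apply {d : ℕ} (z : Pt d) : splitEquiv d z = (fun i => z i.succ, z 0) := rfl

theorem splitEquiv_symm_apply {d : ℕ} (p : (Fin d → ℝ) × ℝ) :
    (splitEquiv d).symm p = mkPt p.1 p.2 := by
  rw [MeasurableEquiv.symm_apply_eq]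
  rfl

theorem measurePreserving_splitEquiv (d : ℕ) : MeasurePreserving (splitEquiv d) :=
  Measure.measurePreserving_swap.comp
    ((volume_preserving_piFinSuccAbove (fun _ : Fin (d + 1) => ℝ) 0).comp
      (EuclideanSpace.volume_preserving_symm_measurableEquiv_toLp (Fin (d + 1))))

/-- The cross-section `(0,1)^d` of the cuboid. -/
def crossSection (d : ℕ) : Set (Fin d → ℝ) := Set.univ.pi fun _ => Set.Ioo (0 : ℝ) 1

theorem volume_crossSection (d : ℕ) : volume (crossSection d) = 1 := by
  rw [crossSection, volume_pi_pi]; simp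

theorem domain_eq_preimage (d : ℕ) (L : ℝ) :
    domain d L = splitEquiv d ⁻¹' (crossSection d ×ˢ Set.Ioo (-L) L) := by
  ext z
  simp [domain, splitEquiv_apply, crossSection, and_comm]

theorem measurableSet_crossSection (d : ℕ) : MeasurableSet (crossSection d) :=
  MeasurableSet.univ_pi fun _ => measurableSet_Ioo

theorem measurableSet_domain (d : ℕ) (L : ℝ) : MeasurableSet (domain d L) := by
  rw [domain_eq_preimage]
  exact (splitEquiv d).measurable ((measurableSet_crossSection d).prod measurableSet_Ioo)

theorem volume_domain (d : ℕ) (L : ℝ) : volume (domain d L) = ENNReal.ofReal (2 * L) := by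
  rw [domain_eq_preimage, (measurePreserving_splitEquiv d).measure_preimage_equiv,
    Measure.volume_eq_prod, Measure.prod_prod, volume_crossSection, one_mul, Real.volume_Ioo]
  congr 1; ring

theorem volume_domain_lt_top (d : ℕ) (L : ℝ) : volume (domain d L) < ⊤ := by
  rw [volume_domain]; exact ENNReal.ofReal_lt_top

theorem isOpen_domain (d : ℕ) (L : ℝ) : IsOpen (domain d L) := by
  have h : domain d L = (fun z : Pt d => z 0) ⁻¹' Set.Ioo (-L) L ∩
      ⋂ i : Fin d, (fun z : Pt d => z i.succ) ⁻¹' Set.Ioo (0 : ℝ) 1 := by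
    ext z; simp [domain]
  rw [h]
  exact (isOpen_Ioo.preimage (by fun_prop)).inter
    (isOpen_iInter_of_finite fun i => isOpen_Ioo.preimage (by fun_prop))

theorem setIntegral_domain (d : ℕ) (L : ℝ) (f : Pt d → ℝ) :
    ∫ z in domain d L, f z = ∫ p in crossSection d ×ˢ Set.Ioo (-L) L, f (mkPt p.1 p.2) := by
  rw [domain_eq_preimage, ← (measurePreserving_splitEquiv d).setIntegral_preimage_emb
    (splitEquiv d).measurableEmbedding]
  simp only [← splitEquiv_symm_apply, MeasurableEquiv.symm_apply_apply]

/-- Integrals over `D_L` of functions of `x` alone. -/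
theorem setIntegral_domain_comp (d : ℕ) (L : ℝ) (f : ℝ → ℝ) :
    ∫ z in domain d L, f (z 0) = ∫ x in Set.Ioo (-L) L, f x := by
  rw [setIntegral_domain]
  have h := setIntegral_prod_mul (μ := (volume : Measure (Fin d → ℝ)))
    (ν := (volume : Measure ℝ)) (fun _ => (1 : ℝ)) f (crossSection d) (Set.Ioo (-L) L)
  simp only [one_mul, mkPt_zero] at h ⊢
  rw [Measure.volume_eq_prod, h]
  simp [Measure.real, volume_crossSection]

theorem norm_gradient {d : ℕ} (h : Pt d → ℝ) (z : Pt d) : ‖gradient h z‖ = ‖fderiv ℝ h z‖ :=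
  LinearIsometryEquiv.norm_map _ _

theorem measurable_norm_gradient {d : ℕ} (h : Pt d → ℝ) : Measurable fun z => ‖gradient h z‖ := by
  simp only [norm_gradient]
  exact (measurable_fderiv ℝ h).norm

/-- On almost every line in the `x`-direction, increments of a Lipschitz function are bounded by
integrals of the norm of the gradient. -/
theorem ae_abs_sub_le_integral_gradient {d : ℕ} {h : Pt d → ℝ} {C : NNReal}
    (hC : LipschitzWith C h) :
    ∀ᵐ y : Fin d → ℝ, ∀ x₁ x₂ : ℝ, x₁ ≤ x₂ →
      |h (mkPt y x₂) - h (mkPt y x₁)| ≤ ∫ x in x₁..x₂, ‖gradient h (mkPt y x)‖ := by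
  have hdiff : ∀ᵐ p : (Fin d → ℝ) × ℝ, DifferentiableAt ℝ h (mkPt p.1 p.2) := by
    have := (measurePreserving_splitEquiv d).symm.quasiMeasurePreserving.ae
      hC.ae_differentiableAt
    simpa only [splitEquiv_symm_apply] using this
  rw [Measure.volume_eq_prod] at hdiff
  filter_upwards [Measure.ae_ae_of_ae_prod hdiff] with y hy x₁ x₂ hx
  set φ : ℝ → ℝ := fun x => h (mkPt y x) with hφ
  have hφL : LipschitzWith C φ := by
    refine LipschitzWith.of_dist_le_mul fun x x' => (hC.dist_le_mul _ _).trans ?_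
    rw [dist_eq_norm (mkPt y x), mkPt_sub_mkPt, PiLp.norm_single, dist_eq_norm]
  have hder : ∀ᵐ x : ℝ, ‖deriv φ x‖ ≤ ‖gradient h (mkPt y x)‖ := by
    filter_upwards [hy] with x hx
    have hline : HasDerivAt (fun x => mkPt y x) (EuclideanSpace.single 0 (1 : ℝ) : Pt d) x := by
      have e : (fun x => mkPt y x) =
          fun x => mkPt y 0 + x • (EuclideanSpace.single 0 (1 : ℝ) : Pt d) := by
        funext x
        ext i
        refine Fin.cases ?_ (fun j => ?_) i <;> simp
      rw [e]
      simpa using ((hasDerivAt_id x).smul_const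
        (EuclideanSpace.single 0 (1 : ℝ) : Pt d)).const_add (mkPt y 0)
    have := (hx.hasFDerivAt.comp_hasDerivAt x hline).deriv
    change deriv φ x = _ at this
    rw [this, norm_gradient]
    refine ((fderiv ℝ h (mkPt y x)).le_opNorm _).trans ?_
    simp
  have hac := (hφL.lipschitzOnWith (s := Set.uIcc x₁ x₂)).absolutelyContinuousOnInterval
  have hmk : Measurable fun x : ℝ => mkPt y x := by
    have := (splitEquiv d).symm.measurable.comp (measurable_const.prodMk measurable_id :
      Measurable fun x : ℝ => (y, x))
    simpa only [Function.comp_def, splitEquiv_symm_apply] using this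
  have hint : IntervalIntegrable (fun x => ‖gradient h (mkPt y x)‖) volume x₁ x₂ := by
    refine (intervalIntegrable_const (c := (C : ℝ))).mono_fun
      ((measurable_norm_gradient h).comp hmk).aestronglyMeasurable
      (Eventually.of_forall fun x => ?_)
    simp only [norm_norm, norm_gradient]
    exact (norm_fderiv_le_of_lipschitz ℝ hC).trans (le_abs_self _)
  change |φ x₂ - φ x₁| ≤ _
  rw [← hac.integral_deriv_eq_sub, ← Real.norm_eq_abs]
  refine (intervalIntegral.norm_integral_le_integral_norm (f := deriv φ) hx).trans ?_
  exact intervalIntegral.integral_mono_ae hx hac.intervalIntegrable_deriv.norm hint hder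

/-! ### Lower bounds for the Dirichlet integral -/


/-- The interpolation has the boundary value `1` on the hyperplane `x = ⌊L/a⌋ a`. -/
theorem extend_mkPt_right {d : ℕ} (T : CubeSubdivision d) {L : ℝ} {n : ℕ} (hn : 0 < n)
    (g : latticeDomain d L n → ℝ) {y : Fin d → ℝ} (hy : y ∈ crossSection d) :
    extend T L n g (mkPt y (⌊L / mesh n⌋ * mesh n)) = 1 := by
  have ha := mesh_pos hn
  obtain ⟨s, w, k, -, hw1, hw, hk, hv, hm⟩ :=
    exists_local_representation T ha (mkPt y (⌊L / mesh n⌋ * mesh n))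
  rw [extend, hw, ← hw1]
  refine Finset.sum_congr rfl fun v hvs => ?_
  rcases eq_or_ne (w v) 0 with h | h
  · simp [h]
  · rw [gridValues_right hn g, mul_one]
    · intro i
      exact mesh_mul_mem_Icc hn (hy i (Set.mem_univ i)) (hk i.succ).1 (hk i.succ).2 (hv v hvs i.succ)
    · have h0 := hm 0 ⌊L / mesh n⌋ (by rw [mkPt_zero, mul_comm]) v hvs h
      rw [PiLp.smul_apply, h0, smul_eq_mul, mul_comm]

theorem extend_of_mem {d : ℕ} (T : CubeSubdivision d) {L : ℝ} {n : ℕ} (hn : 0 < n)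
    (g : latticeDomain d L n → ℝ) (z : latticeDomain d L n) : extend T L n g z = g z := by
  rw [extend, interpolate_grid T (mesh_pos hn) _ z.2.2, gridValues_of_mem g z.2]

theorem dirichlet_nonneg {d : ℕ} (L : ℝ) (h : Pt d → ℝ) : 0 ≤ dirichlet L h :=
  integral_nonneg fun _ => sq_nonneg _

theorem norm_le_sum_abs {d : ℕ} (z : Pt d) : ‖z‖ ≤ ∑ i, |z i| := by
  rw [EuclideanSpace.norm_eq]
  refine Real.sqrt_le_iff.2 ⟨Finset.sum_nonneg fun _ _ => abs_nonneg _, ?_⟩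
  simp only [Real.norm_eq_abs]
  exact Finset.sum_sq_le_sq_sum_of_nonneg fun _ _ => abs_nonneg _

/-- If a Lipschitz function increases by at least `m` along all lines in the `x`-direction over a
set `Q` of the cross-section, then its Dirichlet integral is bounded below. -/
theorem dirichlet_lower_of_lines {d : ℕ} {L : ℝ} (hL : 0 < L) {h : Pt d → ℝ} {C : NNReal}
    (hC : LipschitzWith C h) {Q : Set (Fin d → ℝ)} (hQ : MeasurableSet Q)
    (hQs : Q ⊆ crossSection d) {x₁ x₂ m : ℝ} (hx₁ : -L ≤ x₁) (hx : x₁ ≤ x₂) (hx₂ : x₂ ≤ L)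
    (hm0 : 0 ≤ m) (hm : ∀ y ∈ Q, m ≤ |h (mkPt y x₂) - h (mkPt y x₁)|) :
    (volume.real Q * m) ^ 2 / (2 * L) ≤ dirichlet L h := by
  have hQfin : volume Q ≠ ⊤ := ne_top_of_le_ne_top (by rw [volume_crossSection]; simp)
    (measure_mono hQs)
  have hvD := volume_domain_lt_top d L
  have hbd : ∀ z, ‖gradient h z‖ ≤ C := fun z => by
    rw [norm_gradient]; exact norm_fderiv_le_of_lipschitz ℝ hC
  have hmeas := measurable_norm_gradient h
  have hmk : Measurable fun p : (Fin d → ℝ) × ℝ => mkPt p.1 p.2 := by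
    rw [show (fun p : (Fin d → ℝ) × ℝ => mkPt p.1 p.2) = (splitEquiv d).symm from
      funext fun p => (splitEquiv_symm_apply p).symm]
    exact (splitEquiv d).symm.measurable
  have hint : IntegrableOn (fun p : (Fin d → ℝ) × ℝ => ‖gradient h (mkPt p.1 p.2)‖)
      (crossSection d ×ˢ Set.Ioo (-L) L) (volume.prod volume) := by
    refine Measure.integrableOn_of_bounded (M := C) ?_
      (hmeas.comp hmk).aestronglyMeasurable (Eventually.of_forall fun p => ?_)
    · rw [Measure.prod_prod, volume_crossSection, Real.volume_Ioo]; simp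
    · rw [norm_norm]; exact hbd _
  have hsub : Q ×ˢ Set.Ioo (-L) L ⊆ crossSection d ×ˢ Set.Ioo (-L) L :=
    Set.prod_mono hQs le_rfl
  have h1 : ∫ _y in Q, m ≤ ∫ y in Q, ∫ x in Set.Ioo (-L) L, ‖gradient h (mkPt y x)‖ := by
    have hint' := hint.mono_set hsub
    rw [IntegrableOn, ← Measure.prod_restrict] at hint'
    refine setIntegral_mono_ae_restrict (integrableOn_const hQfin) hint'.integral_prod_left ?_
    filter_upwards [ae_restrict_mem hQ, ae_restrict_of_ae (ae_abs_sub_le_integral_gradient hC)]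
      with y hy hline
    refine (hm y hy).trans ((hline x₁ x₂ hx).trans ?_)
    rw [intervalIntegral.integral_of_le hx, ← integral_Ioc_eq_integral_Ioo]
    refine setIntegral_mono_set ?_ (Eventually.of_forall fun _ => norm_nonneg _)
      (LE.le.eventuallyLE (Set.Ioc_subset_Ioc hx₁ hx₂))
    refine Measure.integrableOn_of_bounded (M := C) (by simp)
      (hmeas.comp (hmk.comp measurable_prodMk_left)).aestronglyMeasurable
      (Eventually.of_forall fun x => ?_)
    rw [norm_norm]; exact hbd _
  have h2 : volume.real Q * m ≤ ∫ z in domain d L, ‖gradient h z‖ := by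
    rw [setIntegral_domain, Measure.volume_eq_prod]
    rw [setIntegral_const, smul_eq_mul] at h1
    refine h1.trans ?_
    rw [← setIntegral_prod (fun p : (Fin d → ℝ) × ℝ => ‖gradient h (mkPt p.1 p.2)‖)
      (hint.mono_set hsub)]
    exact setIntegral_mono_set hint (Eventually.of_forall fun _ => norm_nonneg _)
      (LE.le.eventuallyLE hsub)
  have hsq : IntegrableOn (fun z : Pt d => ‖gradient h z‖ ^ 2) (domain d L) := by
    refine Measure.integrableOn_of_bounded (M := (C : ℝ) ^ 2) hvD.ne
      (hmeas.pow_const 2).aestronglyMeasurable (Eventually.of_forall fun p => ?_)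
    rw [norm_pow, norm_norm]
    exact pow_le_pow_left₀ (norm_nonneg _) (hbd _) 2
  -- `t` is the optimal parameter in `‖∇h‖ ≤ t/2 + ‖∇h‖²/(2t)`
  rcases (mul_nonneg measureReal_nonneg hm0 : 0 ≤ volume.real Q * m).eq_or_lt with h0 | h0
  · rw [← h0]; simpa using dirichlet_nonneg L h
  set t := volume.real Q * m / (2 * L) with ht
  have ht0 : 0 < t := by positivity
  have h3 : ∫ z in domain d L, ‖gradient h z‖ ≤
      ∫ z in domain d L, (t / 2 + 1 / (2 * t) * ‖gradient h z‖ ^ 2) := by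
    refine setIntegral_mono_on ?_ ?_ (measurableSet_domain d L) fun z _ => ?_
    · refine Measure.integrableOn_of_bounded (M := C) hvD.ne
        hmeas.aestronglyMeasurable (Eventually.of_forall fun p => ?_)
      rw [norm_norm]; exact hbd _
    · exact (integrableOn_const hvD.ne).add (hsq.const_mul _)
    · rw [← sub_nonneg]
      have : t / 2 + 1 / (2 * t) * ‖gradient h z‖ ^ 2 - ‖gradient h z‖ =
          1 / (2 * t) * (‖gradient h z‖ - t) ^ 2 := by field_simp; ring
      rw [this]; positivity
  rw [integral_add (integrableOn_const hvD.ne).integrable (hsq.const_mul _), integral_const_mul,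
    setIntegral_const, Measure.real, volume_domain, ENNReal.toReal_ofReal (by positivity),
    smul_eq_mul] at h3
  change _ ≤ _ + 1 / (2 * t) * dirichlet L h at h3
  have h4 : volume.real Q * m = 2 * L * t := by rw [ht]; field_simp
  rw [h4] at h2 ⊢
  have h5 : L * t ≤ 1 / (2 * t) * dirichlet L h := by linarith
  rw [one_div, inv_mul_eq_div, le_div_iff₀ (by positivity)] at h5
  rw [div_le_iff₀ (by positivity)]
  nlinarith

/-! ### Coercivity and the partition function of the free field -/


theorem abs_extend_sub_extend_le {d : ℕ} (T : CubeSubdivision d) {K : ℝ}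
    (hK : ∀ a : ℝ, 0 < a → ∀ (u : Pt d → ℝ) (M : ℝ), (∀ z, |u z| ≤ M) →
      ∀ x y, |interpolate T a u y - interpolate T a u x| ≤ K * M / a * ‖y - x‖)
    {L : ℝ} {n : ℕ} (hn : 0 < n) (g : latticeDomain d L n → ℝ) {M : ℝ} (hM : 2 ≤ M)
    (hg : ∀ z, |g z - 1| ≤ M) (x y : Pt d) :
    |extend T L n g y - extend T L n g x| ≤ K * M / mesh n * ‖y - x‖ := by
  have ha := mesh_pos hn
  have h := hK _ ha (fun z => gridValues L n g z + -1) M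
    (fun z => by rw [← sub_eq_add_neg]; exact abs_gridValues_sub_one_le g hM hg z) x y
  simp only [interpolate_add T ha.ne', interpolate_const T ha.ne', add_sub_add_right_eq_sub] at h
  exact h

/-- Every point of the closed cross-section is a vertex of a cube of side `ρ` inside the open
one. -/
theorem exists_cube_subset_crossSection {d : ℕ} {ρ : ℝ} (hρ0 : 0 < ρ) (hρ : ρ ≤ 1 / 2)
    {y : Fin d → ℝ} (hy : ∀ i, y i ∈ Set.Icc (0 : ℝ) 1) :
    ∃ Q ⊆ crossSection d, MeasurableSet Q ∧ volume.real Q = ρ ^ d ∧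
      ∀ y' ∈ Q, ∀ i, |y' i - y i| ≤ ρ := by
  set l : Fin d → ℝ := fun i => if y i ≤ 1 / 2 then y i else y i - ρ with hl
  have hl' : ∀ i, 0 ≤ l i ∧ l i + ρ ≤ 1 ∧ y i - ρ ≤ l i ∧ l i ≤ y i := by
    intro i
    have := hy i
    simp only [hl]
    split_ifs with h
    · exact ⟨this.1, by linarith, by linarith, le_rfl⟩
    · push Not at h
      exact ⟨by linarith, by linarith [this.2], le_rfl, by linarith⟩
  refine ⟨Set.univ.pi fun i => Set.Ioo (l i) (l i + ρ), ?_, ?_, ?_, ?_⟩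
  · intro y' h i hi
    have := h i hi
    exact ⟨(hl' i).1.trans_lt this.1, this.2.trans_le (hl' i).2.1⟩
  · exact MeasurableSet.univ_pi fun _ => measurableSet_Ioo
  · rw [Measure.real, Real.volume_pi_Ioo_toReal fun i => by linarith]
    simp
  · intro y' h i
    have := h i (Set.mem_univ i)
    have h2 := (hl' i).2.2
    exact abs_le.2 ⟨by linarith [this.1], by linarith [this.2]⟩

/-- Coercivity of the Dirichlet integral on `ℋ^{L,a}`, with a constant that decays like a power
of the mesh size and of `1/L`. -/
theorem exists_dirichlet_coercive {d : ℕ} (T : CubeSubdivision d) :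
    ∃ c : ℝ, 0 < c ∧ ∀ (L : ℝ) (n : ℕ), 0 < n → 0 < L → ∀ (g : latticeDomain d L n → ℝ) (z),
      c * mesh n ^ (2 * d) / L * ((g z - 1) ^ 2 - 4) ≤ dirichlet L (extend T L n g) := by
  obtain ⟨K, hK1, hK⟩ := T.exists_interpolate_lipschitz
  have hK0 : 0 < K := by linarith
  refine ⟨((2 * K * (d + 1))⁻¹ ^ d) ^ 2 / 8, by positivity, fun L n hn hL g z₁ => ?_⟩
  have ha := mesh_pos hn
  have ha1 := mesh_le_one hn
  obtain ⟨z, -, hz⟩ := Finset.exists_max_image Finset.univ (fun z => |g z - 1|)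
    ⟨z₁, Finset.mem_univ _⟩
  set M := |g z - 1| with hM
  set c := ((2 * K * (d + 1))⁻¹ ^ d) ^ 2 / 8 with hc
  have hc0 : 0 < c := by positivity
  have hz₁ : (g z₁ - 1) ^ 2 ≤ M ^ 2 := by
    rw [← sq_abs]
    exact pow_le_pow_left₀ (abs_nonneg _) (hz z₁ (Finset.mem_univ _)) 2
  have hb : 0 < c * mesh n ^ (2 * d) / L := by positivity
  -- the boundary value `-1` has distance `2` from `1`, so the maximum only counts if `M ≥ 2`
  rcases lt_or_ge M 2 with hM2 | hM2
  · refine le_trans ?_ (dirichlet_nonneg _ _)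
    have hM0 : 0 ≤ M := abs_nonneg _
    exact mul_nonpos_of_nonneg_of_nonpos hb.le (by nlinarith)
  -- near the maximum point `z` the interpolation keeps half of its distance to the boundary value
  set ρ := mesh n / (2 * K * (d + 1)) with hρ
  have hd : (0 : ℝ) ≤ d := Nat.cast_nonneg d
  have hden : 2 ≤ 2 * K * (d + 1) := by nlinarith
  have hρ0 : 0 < ρ := by positivity
  have hρ2 : ρ ≤ 1 / 2 := by
    rw [hρ]
    exact div_le_div₀ zero_le_one ha1 two_pos hden
  obtain ⟨Q, hQs, hQ, hQv, hQy⟩ := exists_cube_subset_crossSection hρ0 hρ2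
    (y := fun i => (z : Pt d) i.succ) z.2.1.2
  have hLip := abs_extend_sub_extend_le T hK hn g hM2 (fun z => hz z (Finset.mem_univ _))
  have hLW : LipschitzWith (K * M / mesh n).toNNReal (extend T L n g) :=
    LipschitzWith.of_dist_le' fun x y => by
      rw [Real.dist_eq, dist_eq_norm]; exact hLip y x
  have hzx := z.2.1.1
  have hfl := sub_mesh_lt_floor (L := L) hn
  have key := dirichlet_lower_of_lines hL hLW hQ hQs (x₁ := (z : Pt d) 0)
    (x₂ := ⌊L / mesh n⌋ * mesh n) (m := M / 2) (by linarith [hzx.1]) (by linarith [hzx.2])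
    (floor_mul_mesh_le hn) (by linarith) (fun y hy => by
      rw [extend_mkPt_right T hn g (hQs hy)]
      have h1 := hLip z (mkPt y ((z : Pt d) 0))
      rw [extend_of_mem T hn] at h1
      have h2 : ‖mkPt y ((z : Pt d) 0) - z‖ ≤ d * ρ := by
        refine (norm_le_sum_abs _).trans ?_
        rw [Fin.sum_univ_succ]
        simp only [PiLp.sub_apply, mkPt_zero, sub_self, abs_zero, zero_add, mkPt_succ]
        refine (Finset.sum_le_sum fun i _ => hQy y hy i).trans ?_
        simp
      have h3 : K * M / mesh n * (d * ρ) ≤ M / 2 := by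
        have e : K * M / mesh n * (d * ρ) = M / 2 * (d / (d + 1)) := by
          rw [hρ]; field_simp
        rw [e]
        have : (d : ℝ) / (d + 1) ≤ 1 := by rw [div_le_one (by linarith)]; linarith
        nlinarith
      have h4 := h1.trans ((mul_le_mul_of_nonneg_left h2 (by positivity)).trans h3)
      have h5 := abs_sub_le (g z) (extend T L n g (mkPt y ((z : Pt d) 0))) 1
      rw [abs_sub_comm (g z) (extend T L n g _), abs_sub_comm (extend T L n g _) 1] at h5
      linarith)
  rw [hQv] at key
  refine le_trans ?_ key
  have e : (ρ ^ d * (M / 2)) ^ 2 / (2 * L) = c * mesh n ^ (2 * d) / L * M ^ 2 := by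
    rw [hρ, hc, div_eq_mul_inv (mesh n), mul_pow, mul_comm 2 d, pow_mul]
    ring
  rw [e]
  exact mul_le_mul_of_nonneg_left (by linarith) hb.le

/-- A bound for the partition function of the free field by a product of Gaussian integrals. -/
theorem Z₁_le {d : ℕ} (T : CubeSubdivision d) {L : ℝ} {n : ℕ} {ε b : ℝ} (hε : 0 < ε) (hb : 0 < b)
    (hN : 0 < Fintype.card (latticeDomain d L n))
    (hco : ∀ (g : latticeDomain d L n → ℝ) (z),
      b * ((g z - 1) ^ 2 - 4) ≤ dirichlet L (extend T L n g)) :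
    Z₁ T L n ε ≤ ENNReal.ofReal (Real.exp (2 * b / ε) *
      Real.sqrt (2 * Real.pi * ε * Fintype.card (latticeDomain d L n) / b) ^
        Fintype.card (latticeDomain d L n)) := by
  set N := Fintype.card (latticeDomain d L n) with hNdef
  have hN' : (0 : ℝ) < N := by exact_mod_cast hN
  set β := b / (2 * ε * N) with hβ
  have hβ0 : 0 < β := by positivity
  have hpt : ∀ g : latticeDomain d L n → ℝ, gaussDensity T L n ε g ≤
      ENNReal.ofReal (Real.exp (2 * b / ε) * ∏ z, Real.exp (-β * (g z - 1) ^ 2)) := by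
    intro g
    refine ENNReal.ofReal_le_ofReal ?_
    rw [← Real.exp_sum, ← Real.exp_add]
    refine Real.exp_le_exp.2 ?_
    have h1 : ∑ z, b * ((g z - 1) ^ 2 - 4) ≤ N * dirichlet L (extend T L n g) := by
      refine (Finset.sum_le_sum fun z _ => hco g z).trans (le_of_eq ?_)
      rw [Finset.sum_const, Finset.card_univ, nsmul_eq_mul]
    rw [← Finset.mul_sum, Finset.sum_sub_distrib, Finset.sum_const, Finset.card_univ,
      nsmul_eq_mul] at h1
    rw [← Finset.mul_sum]
    set q := ∑ z, (g z - 1) ^ 2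
    have e : 2 * b / ε + -β * q = -(1 / (2 * ε * N)) * (b * (q - N * 4)) := by
      rw [hβ]; field_simp; ring
    have e' : -(1 / (2 * ε)) * dirichlet L (extend T L n g) =
      -(1 / (2 * ε * N)) * (N * dirichlet L (extend T L n g)) := by field_simp
    rw [e, e']
    exact mul_le_mul_of_nonpos_left h1 (by rw [neg_nonpos]; positivity)
  refine (lintegral_mono hpt).trans ?_
  have hI : Integrable fun t : ℝ => Real.exp (-β * (t - 1) ^ 2) :=
    (integrable_exp_neg_mul_sq hβ0).comp_sub_right 1
  have hIp : Integrable fun g : latticeDomain d L n → ℝ =>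
      Real.exp (2 * b / ε) * ∏ z, Real.exp (-β * (g z - 1) ^ 2) :=
    (Integrable.fintype_prod (fun _ => hI)).const_mul _
  rw [← ofReal_integral_eq_lintegral_ofReal hIp (Eventually.of_forall fun g => by positivity)]
  refine ENNReal.ofReal_le_ofReal (le_of_eq ?_)
  rw [integral_const_mul, integral_fintype_prod_volume_eq_pow
    (fun t : ℝ => Real.exp (-β * (t - 1) ^ 2)),
    integral_sub_right_eq_self (fun t : ℝ => Real.exp (-β * t ^ 2)) 1, integral_gaussian]
  congr 3
  rw [hβ]; field_simp

/-! ### Energy near the discretized profile -/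


theorem IsDoubleWell.exists_lipschitz {F : ℝ → ℝ} (hF : IsDoubleWell F) :
    ∃ l : ℝ, 0 ≤ l ∧ ∀ u v, |u| ≤ 2 → |v| ≤ 2 → |F u - F v| ≤ l * |u - v| := by
  have hd : Differentiable ℝ F := hF.contDiff.differentiable (by norm_num)
  have hc : Continuous (deriv F) := hF.contDiff.continuous_deriv (by norm_num)
  obtain ⟨l, hl⟩ := (isCompact_Icc (a := (-2 : ℝ)) (b := 2)).exists_bound_of_continuousOn
    hc.continuousOn
  refine ⟨l, (norm_nonneg _).trans (hl 0 (by norm_num)), fun u v hu hv => ?_⟩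
  exact (convex_Icc (-2 : ℝ) 2).norm_image_sub_le_of_norm_deriv_le (fun x _ => hd x) hl
    (abs_le.1 hv) (abs_le.1 hu)

/-- Interpolation of a function of `x` alone: it is as close to that function, and locally as
Lipschitz, as the slopes of the function near `x` permit. -/
theorem interpolate_profile {d : ℕ} (T : CubeSubdivision d) {a : ℝ} (ha : 0 < a) {U : ℝ → ℝ}
    {z : Pt d} {τ : ℝ} (hτ0 : 0 ≤ τ)
    (hτ : ∀ x₁ x₂, x₁ < x₂ → |x₁ - z 0| ≤ a → |x₂ - z 0| ≤ a → |U x₂ - U x₁| ≤ τ * (x₂ - x₁)) :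
    |interpolate T a (fun z => U (z 0)) z - U (z 0)| ≤ τ * a ∧
      ∀ᶠ z' in 𝓝 z, |interpolate T a (fun z => U (z 0)) z' -
        interpolate T a (fun z => U (z 0)) z| ≤ τ * ‖z' - z‖ := by
  constructor
  · obtain ⟨s, w, k, hw0, hw1, hw, hk, hv, -⟩ := exists_local_representation T ha z
    have hb : ∀ v ∈ s, |U (a * v 0) - U (z 0)| ≤ τ * a := by
      intro v hvs
      have h1 : |a * v 0 - z 0| ≤ a := by
        have := hk 0
        rw [abs_le]
        rcases hv v hvs 0 with h | h <;> rw [h] <;> constructor <;> linarith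
      have h0 : |z 0 - z 0| ≤ a := by simpa using ha.le
      rcases lt_trichotomy (a * v 0) (z 0) with h | h | h
      · rw [abs_sub_comm]
        refine (hτ _ _ h h1 h0).trans (mul_le_mul_of_nonneg_left ?_ hτ0)
        linarith [neg_abs_le (a * v 0 - z 0)]
      · rw [h]; simp only [sub_self, abs_zero]; positivity
      · refine (hτ _ _ h h0 h1).trans (mul_le_mul_of_nonneg_left ?_ hτ0)
        linarith [le_abs_self (a * v 0 - z 0)]
    have e : interpolate T a (fun z => U (z 0)) z - U (z 0) =
        ∑ v ∈ s, w v * (U (a * v 0) - U (z 0)) := by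
      simp only [hw, mul_sub, Finset.sum_sub_distrib, ← Finset.sum_mul, hw1, one_mul,
        PiLp.smul_apply, smul_eq_mul]
    rw [e]
    exact abs_le.2 (weighted_sum_mem_Icc hw0 hw1 fun v hv => abs_le.1 (hb v hv))
  · have hcont : Continuous fun y : Pt d => a⁻¹ • y := continuous_const_smul _
    filter_upwards [(hcont.tendsto z) (T.eventually_common_face (a⁻¹ • z))] with z' hz'
    obtain ⟨s, hs, hx, hy⟩ := hz'
    obtain ⟨w, hw0, hw1, hwx, hw⟩ := interpolate_eq_sum T ha.ne' hs hx
    obtain ⟨w', hw0', hw1', hwy, hw'⟩ := interpolate_eq_sum T ha.ne' hs hy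
    obtain ⟨k, hk⟩ := T.corners s hs
    have hcoord : ∀ (w : Pt d → ℝ) (z : Pt d), ∑ v ∈ s, w v • (a • v) = z →
        ∑ v ∈ s, w v * (a * v 0) = z 0 := by
      intro w z h
      rw [← h]
      simp only [WithLp.ofLp_sum, Finset.sum_apply, PiLp.smul_apply, smul_eq_mul]
    set x₁ := a * (k 0 : ℝ) with hx₁
    set x₂ := a * (k 0 : ℝ) + a with hx₂
    have hz0 : z 0 ∈ Set.Icc x₁ x₂ := by
      rw [← hcoord w z hwx]
      refine weighted_sum_mem_Icc hw0 hw1 fun v hv => ?_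
      rcases hk v hv 0 with h | h <;> rw [h] <;> constructor <;> linarith
    -- on the cube the grid values are an affine function of `x`
    have haff : ∀ v ∈ s, U (a * v 0) = U x₁ + (U x₂ - U x₁) / a * (a * v 0 - x₁) := by
      intro v hv
      rcases hk v hv 0 with h | h
      · rw [h, ← hx₁]; ring
      · have e : a * ((k 0 : ℝ) + 1) = x₂ := by rw [hx₂]; ring
        rw [h, e, hx₂]; field_simp; ring
    have hval : ∀ (w : Pt d → ℝ) (z : Pt d), ∑ v ∈ s, w v = 1 → ∑ v ∈ s, w v • (a • v) = z →
        ∑ v ∈ s, w v * U ((a • v) 0) = U x₁ + (U x₂ - U x₁) / a * (z 0 - x₁) := by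
      intro w z h1 h
      have : ∀ v ∈ s, w v * U ((a • v) 0) =
          w v * (U x₁ - (U x₂ - U x₁) / a * x₁) + (U x₂ - U x₁) / a * (w v * (a * v 0)) := by
        intro v hv
        rw [PiLp.smul_apply, smul_eq_mul, haff v hv]; ring
      rw [Finset.sum_congr rfl this, Finset.sum_add_distrib, ← Finset.sum_mul, h1,
        ← Finset.mul_sum, hcoord w z h]
      ring
    rw [hw, hw', hval w z hw1 hwx, hval w' z' hw1' hwy]
    have e : U x₁ + (U x₂ - U x₁) / a * (z' 0 - x₁) - (U x₁ + (U x₂ - U x₁) / a * (z 0 - x₁)) =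
        (U x₂ - U x₁) / a * (z' - z) 0 := by rw [PiLp.sub_apply]; ring
    rw [e, abs_mul, abs_div, abs_of_pos ha]
    have h1 := hτ x₁ x₂ (by linarith) (abs_le.2 ⟨by linarith [hz0.2], by linarith [hz0.1]⟩)
      (abs_le.2 ⟨by linarith [hz0.2], by linarith [hz0.1]⟩)
    refine mul_le_mul ?_ (PiLp.norm_apply_le (z' - z) 0) (abs_nonneg _) hτ0
    rw [div_le_iff₀ ha]
    exact h1.trans (le_of_eq (by rw [hx₂]; ring))

/-- On `D_L`, the function with grid values close to `U(x)` is the sum of the interpolation of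
`U(x)` and of the interpolation of small grid values. -/
theorem exists_extend_eq_add {d : ℕ} (T : CubeSubdivision d) {L : ℝ} {n : ℕ} (hn : 0 < n)
    {U : ℝ → ℝ} {R r : ℝ} (hR : 0 < R) (hr : 0 ≤ r) (hUl : ∀ x ≤ -R, U x = -1)
    (hUr : ∀ x, R ≤ x → U x = 1) (hL : R + 1 ≤ L)
    {g : latticeDomain d L n → ℝ} (hg : ∀ z, |g z - U ((z : Pt d) 0)| ≤ r) :
    ∃ φ : Pt d → ℝ, (∀ z, |φ z| ≤ r) ∧ ∀ z ∈ domain d L, extend T L n g z =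
      interpolate T (mesh n) (fun z => U (z 0)) z + interpolate T (mesh n) φ z := by
  classical
  have ha := mesh_pos hn
  have ha1 := mesh_le_one hn
  have hfl := sub_mesh_lt_floor (L := L) hn
  set P : Pt d → Prop := fun z => (∀ i, ∃ k : ℤ, z i = mesh n * k) ∧
    ∀ i : Fin d, z i.succ ∈ Set.Icc (0 : ℝ) 1 with hP
  refine ⟨fun z => if P z then gridValues L n g z - U (z 0) else 0, fun z => ?_, fun z hz => ?_⟩
  · simp only
    split_ifs with h
    · rcases grid_trichotomy (L := L) hn h.1 h.2 with h' | h' | h'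
      · rw [gridValues_of_mem g h']; exact hg _
      · rw [gridValues_right hn g h.2 h', hUr _ (by linarith)]; simpa using hr
      · rw [gridValues_left hn (by linarith) g h.2 h', hUl _ (by linarith)]; simpa using hr
    · simpa using hr
  · obtain ⟨s, w, k, -, -, hw, hk, hv, -⟩ := exists_local_representation T ha z
    rw [extend, ← interpolate_add T ha.ne', hw, hw]
    refine Finset.sum_congr rfl fun v hvs => ?_
    have hPv : P (mesh n • v) := by
      refine ⟨fun i => ?_, fun i => ?_⟩
      · rcases hv v hvs i with h | h
        · exact ⟨k i, by rw [PiLp.smul_apply, h, smul_eq_mul]⟩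
        · exact ⟨k i + 1, by rw [PiLp.smul_apply, h, smul_eq_mul]; push_cast; rfl⟩
      · exact mesh_mul_mem_Icc hn (hz.2 i) (hk i.succ).1 (hk i.succ).2 (hv v hvs i.succ)
    rw [if_pos hPv, add_sub_cancel]

/-- Integration over `D_L` of a pointwise bound by a function of `x` alone plus a constant. No
measurability of `e` is needed, since the integral of a nonmeasurable `e` is `0`. -/
theorem setIntegral_domain_le {d : ℕ} {L c M : ℝ} (hL : 0 ≤ L) {e : Pt d → ℝ} {f : ℝ → ℝ}
    (he0 : ∀ z, 0 ≤ e z) (hf : Measurable f) (hfM : ∀ x, |f x| ≤ M)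
    (hle : ∀ z ∈ domain d L, e z ≤ f (z 0) + c) :
    ∫ z in domain d L, e z ≤ (∫ x in Set.Ioo (-L) L, f x) + 2 * L * c := by
  have hvD := (volume_domain_lt_top d L).ne
  have hfi : IntegrableOn (fun z : Pt d => f (z 0)) (domain d L) :=
    Measure.integrableOn_of_bounded (M := M) hvD
      (hf.comp (by fun_prop : Measurable fun z : Pt d => z 0)).aestronglyMeasurable
      (Eventually.of_forall fun z => hfM _)
  have hci : IntegrableOn (fun _ : Pt d => c) (domain d L) := integrableOn_const hvD
  calc ∫ z in domain d L, e z ≤ ∫ z in domain d L, (f (z 0) + c) := by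
        refine integral_mono_of_nonneg (Eventually.of_forall he0) (hfi.add hci).integrable ?_
        filter_upwards [ae_restrict_mem (measurableSet_domain d L)] with z hz using hle z hz
    _ = _ := by
        rw [integral_add hfi.integrable hci.integrable, setIntegral_domain_comp, setIntegral_const,
          Measure.real, volume_domain, ENNReal.toReal_ofReal (by positivity), smul_eq_mul]

theorem setIntegral_indicator_le {f : ℝ → ℝ} (hf : Continuous f) (hf0 : ∀ x, 0 ≤ f x) {p q L : ℝ}
    (hpq : p ≤ q) :
    ∫ x in Set.Ioo (-L) L, (Set.Icc p q).indicator f x ≤ ∫ x in p..q, f x := by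
  rw [setIntegral_indicator measurableSet_Icc, intervalIntegral.integral_of_le hpq,
    ← integral_Icc_eq_integral_Ioc]
  exact setIntegral_mono_set hf.continuousOn.integrableOn_Icc (Eventually.of_forall hf0)
    (LE.le.eventuallyLE Set.inter_subset_right)

set_option maxHeartbeats 800000 in
/-- Near a suitable profile the energy exceeds `C_*` only slightly. -/
theorem exists_low_energy {d : ℕ} (T : CubeSubdivision d) {F : ℝ → ℝ} (hF : IsDoubleWell F)
    {η : ℝ} (hη : 0 < η) :
    ∃ (U : ℝ → ℝ) (a₀ L₀ C : ℝ), 0 < a₀ ∧ 0 ≤ C ∧ ∀ (L : ℝ) (n : ℕ) (r : ℝ),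
      0 < n → mesh n ≤ a₀ → L₀ ≤ L → 0 ≤ r → r ≤ mesh n →
      ∃ E₁ E₂ : ℝ, E₁ + E₂ ≤ Cstar F + η + C * L * (r / mesh n) ∧
        ∀ g : latticeDomain d L n → ℝ, (∀ z, |g z - U ((z : Pt d) 0)| ≤ r) →
          1 / 2 * dirichlet L (extend T L n g) ≤ E₁ ∧
          ∫ z in domain d L, F (extend T L n g z) ≤ E₂ := by
  obtain ⟨K, hK1, hK⟩ := T.exists_interpolate_lipschitz
  obtain ⟨l, hl0, hl⟩ := hF.exists_lipschitz
  set δ := min 1 (η / 8) with hδ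
  have hδ0 : 0 < δ := by positivity
  have hδ1 : δ ≤ 1 := min_le_left _ _
  have hδη : δ ≤ η / 8 := min_le_right _ _
  obtain ⟨U, s, A, B, S, hAB, hUc, hU1, hUA, hUB, hs, hs0, hsS, hslope, hen⟩ :=
    exists_profile hF hδ0
  have hS0 : 0 ≤ S := (hs0 0).trans (hsS 0)
  have hFc := hF.continuous
  have hsc := hs.continuous
  -- `W` collects the constants in front of the errors
  set W := (B - A + 2) * ((S + 1) * (1 + l)) with hW
  have hW0 : 0 < W := by have : 0 < B - A + 2 := by linarith
                         positivity
  set η' := min 1 (η / (4 * W)) with hη'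
  have hη'0 : 0 < η' := by positivity
  have hη'1 : η' ≤ 1 := min_le_left _ _
  obtain ⟨a₁, ha₁, has⟩ := Metric.uniformContinuous_iff.1 hs η' hη'0
  refine ⟨U, min (a₁ / 2) η', max |A| |B| + 1 + 1, 2 * ((S + 1) * K + K ^ 2 / 2 + l), by positivity,
    by positivity, fun L n r hn ha₀ hL hr0 hra => ?_⟩
  have ha := mesh_pos hn
  have ha1 := mesh_le_one hn
  have haa₁ : mesh n < a₁ := by linarith [ha₀.trans (min_le_left _ _)]
  have haη : mesh n ≤ η' := ha₀.trans (min_le_right _ _)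
  have hr1 : r ≤ 1 := hra.trans ha1
  have hA' : -(max |A| |B| + 1) ≤ A := by linarith [neg_abs_le A, le_max_left |A| |B|]
  have hB' : B ≤ max |A| |B| + 1 := by linarith [le_abs_self B, le_max_right |A| |B|]
  have hL0 : 0 < L := by linarith [(abs_nonneg A).trans (le_max_left |A| |B|)]
  set t := r / mesh n with ht
  have ht0 : 0 ≤ t := by positivity
  have ht1 : t ≤ 1 := by rw [ht, div_le_one ha]; exact hra
  have hrt : r ≤ t := by rw [ht, le_div_iff₀ ha]; nlinarith
  -- a bound for the slopes of the interpolated profile near `x`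
  set I := Set.Icc (A - 1) (B + 1) with hI
  set τ : ℝ → ℝ := I.indicator fun x => s x + η' with hτ
  have hτ0 : ∀ x, 0 ≤ τ x := fun x => Set.indicator_nonneg (fun x _ => by linarith [hs0 x]) x
  have hτS : ∀ x, τ x ≤ S + 1 := fun x => by
    rw [hτ, Set.indicator_apply]
    split_ifs
    · linarith [hsS x]
    · linarith
  have hτU : ∀ x x₁ x₂, x₁ < x₂ → |x₁ - x| ≤ mesh n → |x₂ - x| ≤ mesh n →
      |U x₂ - U x₁| ≤ τ x * (x₂ - x₁) := by
    intro x x₁ x₂ hx h1 h2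
    rw [abs_le] at h1 h2
    by_cases hxI : x ∈ I
    · rw [hτ, Set.indicator_of_mem hxI]
      obtain ⟨ξ, hξ, hξ'⟩ := hslope x₁ x₂ hx
      refine hξ'.trans (mul_le_mul_of_nonneg_right ?_ (by linarith))
      have := has (a := ξ) (b := x) (by
        rw [Real.dist_eq, abs_lt]; constructor <;> linarith [hξ.1, hξ.2])
      rw [Real.dist_eq, abs_lt] at this
      linarith [this.2]
    · rw [hτ, Set.indicator_of_notMem hxI, zero_mul]
      rw [hI, Set.mem_Icc, not_and_or, not_le, not_le] at hxI
      rcases hxI with hxI | hxI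
      · rw [hUA x₁ (by linarith), hUA x₂ (by linarith)]; simp
      · rw [hUB x₁ (by linarith), hUB x₂ (by linarith)]; simp
  set f₁ : ℝ → ℝ := fun x => 1 / 2 * (s x + η') ^ 2 with hf₁
  set f₂ : ℝ → ℝ := fun x => F (U x) + l * (S + 1) * mesh n with hf₂
  have hf₁c : Continuous f₁ := by fun_prop
  have hf₂c : Continuous f₂ := by fun_prop
  have hf₁0 : ∀ x, 0 ≤ f₁ x := fun x => by positivity
  have hf₂0 : ∀ x, 0 ≤ f₂ x := fun x => add_nonneg (hF.nonneg _) (by positivity)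
  have hτ₁ : ∀ x, 1 / 2 * τ x ^ 2 = I.indicator f₁ x := fun x => by
    by_cases hxI : x ∈ I
    · rw [hτ, Set.indicator_of_mem hxI, Set.indicator_of_mem hxI]
    · rw [hτ, Set.indicator_of_notMem hxI, Set.indicator_of_notMem hxI]; ring
  have hbd : ∀ f : ℝ → ℝ, Continuous f → ∃ M, ∀ x, |I.indicator f x| ≤ M := fun f hf => by
    obtain ⟨M, hM⟩ := isCompact_Icc.exists_bound_of_continuousOn (s := I) hf.continuousOn
    refine ⟨max M 0, fun x => ?_⟩
    by_cases hxI : x ∈ I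
    · rw [Set.indicator_of_mem hxI]; exact (hM x hxI).trans (le_max_left _ _)
    · rw [Set.indicator_of_notMem hxI, abs_zero]; exact le_max_right _ _
  obtain ⟨M₁, hM₁⟩ := hbd f₁ hf₁c
  obtain ⟨M₂, hM₂⟩ := hbd f₂ hf₂c
  have hpq : A - 1 ≤ B + 1 := by linarith
  have hE : (∫ x in (A - 1)..(B + 1), f₁ x) + ∫ x in (A - 1)..(B + 1), f₂ x ≤
      Cstar F + 2 * δ + 2 * δ ^ 2 + W * η' := by
    rw [← intervalIntegral.integral_add (hf₁c.intervalIntegrable _ _)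
      (hf₂c.intervalIntegrable _ _)]
    calc ∫ x in (A - 1)..(B + 1), (f₁ x + f₂ x)
        ≤ ∫ x in (A - 1)..(B + 1), ((1 / 2 * s x ^ 2 + F (U x)) + (S + 1) * (1 + l) * η') := by
          refine intervalIntegral.integral_mono_on hpq
            (Continuous.intervalIntegrable (by fun_prop) _ _)
            (Continuous.intervalIntegrable (by fun_prop) _ _) fun x _ => ?_
          have h1 := mul_le_mul_of_nonneg_left haη (show 0 ≤ l * (S + 1) by positivity)
          have h2 := mul_le_mul_of_nonneg_right (hsS x) hη'0.le
          have h3 : η' ^ 2 ≤ η' := by nlinarith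
          have h4 : 1 / 2 * (s x + η') ^ 2 = 1 / 2 * s x ^ 2 + s x * η' + 1 / 2 * η' ^ 2 := by ring
          have h5 : (S + 1) * (1 + l) * η' = S * η' + η' + l * (S + 1) * η' := by ring
          simp only [hf₁, hf₂]
          rw [h4, h5]
          linarith
      _ = (∫ x in (A - 1)..(B + 1), (1 / 2 * s x ^ 2 + F (U x))) + W * η' := by
          rw [intervalIntegral.integral_add (Continuous.intervalIntegrable (by fun_prop) _ _)
            intervalIntegrable_const, intervalIntegral.integral_const, smul_eq_mul, hW]
          ring
      _ ≤ _ := by linarith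
  have hWη : W * η' ≤ η / 4 := by
    have := mul_le_mul_of_nonneg_left (min_le_right 1 (η / (4 * W))) hW0.le
    refine this.trans (le_of_eq ?_)
    field_simp
  have hδ2 : δ ^ 2 ≤ δ := by nlinarith
  have e : 2 * ((S + 1) * K + K ^ 2 / 2 + l) * L * t =
      2 * L * (((S + 1) * K + K ^ 2 / 2) * t) + 2 * L * (l * t) := by ring
  refine ⟨(∫ x in (A - 1)..(B + 1), f₁ x) + 2 * L * (((S + 1) * K + K ^ 2 / 2) * t),
    (∫ x in (A - 1)..(B + 1), f₂ x) + 2 * L * (l * t), by rw [e]; linarith, fun g hg => ?_⟩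
  obtain ⟨φ, hφ, hext⟩ := exists_extend_eq_add T hn (U := U) (R := max |A| |B| + 1) (by positivity)
    hr0 (fun x hx => hUA x (hx.trans hA')) (fun x hx => hUB x (hB'.trans hx)) hL hg
  set h := extend T L n g with hh
  set H := interpolate T (mesh n) (fun z => U (z 0)) with hH
  set Φ := interpolate T (mesh n) φ with hΦ
  have hΦL : ∀ x y, |Φ y - Φ x| ≤ K * t * ‖y - x‖ := fun x y => by
    have := hK _ ha φ r hφ x y
    rwa [mul_div_assoc] at this
  -- pointwise bounds of the energy densities
  have hgrad : ∀ z ∈ domain d L, 1 / 2 * ‖gradient h z‖ ^ 2 ≤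
      1 / 2 * τ (z 0) ^ 2 + ((S + 1) * K + K ^ 2 / 2) * t := by
    intro z hz
    have h1 : ‖gradient h z‖ ≤ τ (z 0) + K * t := by
      rw [norm_gradient]
      refine norm_fderiv_le_of_lip' ℝ (by have := hτ0 (z 0); positivity) ?_
      filter_upwards [(interpolate_profile T ha (hτ0 (z 0)) (hτU (z 0))).2,
        (isOpen_domain d L).mem_nhds hz] with z' hz' hzd
      rw [hext z hz, hext z' hzd, Real.norm_eq_abs, add_mul]
      have e : H z' + Φ z' - (H z + Φ z) = (H z' - H z) + (Φ z' - Φ z) := by ring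
      rw [e]
      exact (abs_add_le _ _).trans (add_le_add hz' (hΦL z z'))
    have h2 := pow_le_pow_left₀ (norm_nonneg _) h1 2
    have h3 := mul_le_mul_of_nonneg_right (hτS (z 0)) (show 0 ≤ K * t by positivity)
    have h4 : t ^ 2 ≤ t := by nlinarith
    have h5 := mul_le_mul_of_nonneg_left h4 (sq_nonneg K)
    have h6 : (τ (z 0) + K * t) ^ 2 = τ (z 0) ^ 2 + 2 * (τ (z 0) * (K * t)) + K ^ 2 * t ^ 2 := by
      ring
    have h7 : ((S + 1) * K + K ^ 2 / 2) * t = (S + 1) * (K * t) + 1 / 2 * (K ^ 2 * t) := by ring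
    rw [h6] at h2
    rw [h7]
    linarith
  have hpot : ∀ z ∈ domain d L, F (h z) ≤
      I.indicator (fun x => F (U x) + l * (S + 1) * mesh n) (z 0) + l * t := by
    intro z hz
    have h1 : |H z - U (z 0)| ≤ τ (z 0) * mesh n :=
      (interpolate_profile T ha (hτ0 (z 0)) (hτU (z 0))).1
    have h2 : |Φ z| ≤ r := abs_interpolate_le T ha.ne' hφ z
    have h3 : |H z| ≤ 1 := abs_interpolate_le T ha.ne' (fun z => hU1 _) z
    have h4 : |h z| ≤ 2 := by
      rw [hext z hz]; exact (abs_add_le _ _).trans (by linarith)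
    have h5 := (le_abs_self _).trans (hl (h z) (U (z 0)) h4 ((hU1 _).trans (by norm_num)))
    have h6 : |h z - U (z 0)| ≤ τ (z 0) * mesh n + t := by
      have e : h z - U (z 0) = (H z - U (z 0)) + Φ z := by rw [hext z hz]; ring
      rw [e]
      exact (abs_add_le _ _).trans (add_le_add h1 (h2.trans hrt))
    have h7 := mul_le_mul_of_nonneg_left h6 hl0
    by_cases hxI : z 0 ∈ I
    · rw [Set.indicator_of_mem hxI]
      have h8 := mul_le_mul_of_nonneg_left
        (mul_le_mul_of_nonneg_right (hτS (z 0)) ha.le) hl0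
      linarith
    · rw [Set.indicator_of_notMem hxI]
      have h8 : τ (z 0) = 0 := Set.indicator_of_notMem hxI _
      have h9 : F (U (z 0)) = 0 := by
        rw [hF.eq_zero_iff]
        rw [hI, Set.mem_Icc, not_and_or, not_le, not_le] at hxI
        rcases hxI with hxI | hxI
        · exact Or.inr (hUA _ (by linarith))
        · exact Or.inl (hUB _ (by linarith))
      rw [h8] at h7
      linarith
  have hD : 1 / 2 * dirichlet L h ≤
      (∫ x in (A - 1)..(B + 1), f₁ x) + 2 * L * (((S + 1) * K + K ^ 2 / 2) * t) := by
    rw [dirichlet, ← integral_const_mul]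
    refine (setIntegral_domain_le hL0.le (fun z => by positivity)
      (hf₁c.measurable.indicator measurableSet_Icc) hM₁
      (fun z hz => (hτ₁ (z 0)) ▸ hgrad z hz)).trans ?_
    exact add_le_add_left (setIntegral_indicator_le hf₁c hf₁0 hpq) _
  have hP : ∫ z in domain d L, F (h z) ≤
      (∫ x in (A - 1)..(B + 1), f₂ x) + 2 * L * (l * t) := by
    refine (setIntegral_domain_le hL0.le (fun z => hF.nonneg _)
      (hf₂c.measurable.indicator measurableSet_Icc) hM₂ hpot).trans ?_
    exact add_le_add_left (setIntegral_indicator_le hf₂c hf₂0 hpq) _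
  exact ⟨hD, hP⟩

/-! ### The lower bound for `Z^ε` and the dimension of `ℋ^{L,a}` -/


/-- A lower bound for `Z^ε` from the configurations in a small box of grid values on which both
parts of the energy are bounded. -/
theorem Z_ge {d : ℕ} (T : CubeSubdivision d) (F : ℝ → ℝ) {L : ℝ} {n : ℕ} {ε r E₁ E₂ z₁ : ℝ}
    (hε : 0 < ε) (hr : 0 ≤ r) (c : latticeDomain d L n → ℝ) (hz₁ : 0 < z₁)
    (hZ₁ : Z₁ T L n ε ≤ ENNReal.ofReal z₁)
    (hE : ∀ g : latticeDomain d L n → ℝ, (∀ z, |g z - c z| ≤ r) →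
      1 / 2 * dirichlet L (extend T L n g) ≤ E₁ ∧
      ∫ z in domain d L, F (extend T L n g z) ≤ E₂) :
    ENNReal.ofReal (Real.exp (-(E₁ + E₂) / ε) *
      (2 * r) ^ Fintype.card (latticeDomain d L n) / z₁) ≤ Z T F L n ε := by
  set N := Fintype.card (latticeDomain d L n)
  set B : Set (latticeDomain d L n → ℝ) := Set.univ.pi fun z => Set.Icc (c z - r) (c z + r) with hB
  have hBm : MeasurableSet B := MeasurableSet.univ_pi fun _ => measurableSet_Icc
  have hBv : volume B = ENNReal.ofReal ((2 * r) ^ N) := by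
    rw [hB, volume_pi_pi, ENNReal.ofReal_pow (by linarith)]
    simp only [Real.volume_Icc]
    rw [Finset.prod_congr rfl fun z _ => by
      rw [show c z + r - (c z - r) = 2 * r by ring], Finset.prod_const, Finset.card_univ]
  have hBg : ∀ g ∈ B, ∀ z, |g z - c z| ≤ r := fun g hg z => by
    have := hg z (Set.mem_univ z)
    exact abs_le.2 ⟨by linarith [this.1], by linarith [this.2]⟩
  have h1 : ENNReal.ofReal (Real.exp (-E₁ / ε)) * volume B ≤ ∫⁻ g in B, gaussDensity T L n ε g := by
    rw [← setLIntegral_const]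
    refine setLIntegral_mono' hBm fun g hg => ENNReal.ofReal_le_ofReal (Real.exp_le_exp.2 ?_)
    have := (hE g (hBg g hg)).1
    have e : -(1 / (2 * ε)) * dirichlet L (extend T L n g) =
        -(1 / 2 * dirichlet L (extend T L n g)) / ε := by field_simp
    rw [e]
    gcongr
  have h2 : (ENNReal.ofReal z₁)⁻¹ * (ENNReal.ofReal (Real.exp (-E₁ / ε)) * volume B) ≤
      ν₁ T L n ε B := by
    rw [ν₁, Measure.smul_apply, withDensity_apply _ hBm, smul_eq_mul]
    exact mul_le_mul' (ENNReal.inv_le_inv.2 hZ₁) h1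
  have h3 : ENNReal.ofReal (Real.exp (-E₂ / ε)) * ν₁ T L n ε B ≤ Z T F L n ε := by
    refine le_trans ?_ (setLIntegral_le_lintegral B _)
    rw [← setLIntegral_const]
    refine setLIntegral_mono' hBm fun g hg => ENNReal.ofReal_le_ofReal (Real.exp_le_exp.2 ?_)
    have := (hE g (hBg g hg)).2
    have e : -(1 / ε) * ∫ z in domain d L, F (extend T L n g z) =
        -(∫ z in domain d L, F (extend T L n g z)) / ε := by ring
    rw [e]
    gcongr
  refine le_trans ?_ ((mul_le_mul' le_rfl h2).trans h3)
  rw [hBv, ← ENNReal.ofReal_inv_of_pos hz₁, ← ENNReal.ofReal_mul (by positivity),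
    ← ENNReal.ofReal_mul (by positivity), ← ENNReal.ofReal_mul (by positivity)]
  refine ENNReal.ofReal_le_ofReal (le_of_eq ?_)
  rw [show -(E₁ + E₂) / ε = -E₁ / ε + -E₂ / ε by ring, Real.exp_add]
  ring

theorem latticeDomain_subset_closedDomain {d : ℕ} {L : ℝ} {n : ℕ} (hn : 0 < n) {z : Pt d}
    (hz : z ∈ latticeDomain d L n) : z ∈ closedDomain d L := by
  have ha := mesh_pos hn
  exact ⟨⟨by linarith [hz.1.1.1], by linarith [hz.1.1.2]⟩, hz.1.2⟩

open Classical in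
/-- The part of `P g` that is linear in `g`: the interpolation of `g` extended by `0`. -/
noncomputable def extendLinear {d : ℕ} (T : CubeSubdivision d) (L : ℝ) {n : ℕ} (hn : 0 < n) :
    (latticeDomain d L n → ℝ) →ₗ[ℝ] (closedDomain d L → ℝ) where
  toFun g x := interpolate T (mesh n)
    (fun z => if hz : z ∈ latticeDomain d L n then g ⟨z, hz⟩ else 0) x
  map_add' g g' := by
    funext x
    rw [Pi.add_apply, ← interpolate_add T (mesh_pos hn).ne']
    congr 1
    funext z
    split_ifs <;> simp
  map_smul' r g := by
    funext x
    rw [Pi.smul_apply, RingHom.id_apply, smul_eq_mul, ← interpolate_smul T (mesh_pos hn).ne']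
    congr 1
    funext z
    split_ifs <;> simp

theorem extendLinear_injective {d : ℕ} (T : CubeSubdivision d) (L : ℝ) {n : ℕ} (hn : 0 < n) :
    Function.Injective (extendLinear T L hn) := by
  intro g g' h
  funext z
  have h1 : ∀ g : latticeDomain d L n → ℝ,
      extendLinear T L hn g ⟨z, latticeDomain_subset_closedDomain hn z.2⟩ = g z := fun g => by
    change interpolate T (mesh n) _ (z : Pt d) = g z
    rw [interpolate_grid T (mesh_pos hn) _ z.2.2, dif_pos z.2]
  rw [← h1 g, h, h1 g']

theorem extend_eq_add_extendLinear {d : ℕ} (T : CubeSubdivision d) (L : ℝ) {n : ℕ} (hn : 0 < n)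
    (g : latticeDomain d L n → ℝ) :
    (closedDomain d L).domRestrict (extend T L n g) =
      (closedDomain d L).domRestrict (extend T L n 0) + extendLinear T L hn g := by
  funext x
  change interpolate T (mesh n) _ (x : Pt d) = interpolate T (mesh n) _ (x : Pt d) +
    interpolate T (mesh n) _ (x : Pt d)
  rw [← interpolate_add T (mesh_pos hn).ne']
  congr 1
  funext z
  unfold gridValues
  split_ifs <;> simp

/-- The values at the points of `D_{L,a}` are coordinates on `ℋ^{L,a}`. -/
theorem dimPL_eq_card {d : ℕ} (T : CubeSubdivision d) (L : ℝ) {n : ℕ} (hn : 0 < n) :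
    dimPL T L n = Fintype.card (latticeDomain d L n) := by
  have h : vectorSpan ℝ (plSpace T L n) = LinearMap.range (extendLinear T L hn) := by
    rw [vectorSpan_def, ← Submodule.span_eq (LinearMap.range (extendLinear T L hn))]
    congr 1
    ext f
    constructor
    · rintro ⟨_, ⟨g, rfl⟩, _, ⟨g', rfl⟩, rfl⟩
      refine ⟨g - g', ?_⟩
      simp only [vsub_eq_sub]
      rw [extend_eq_add_extendLinear T L hn g, extend_eq_add_extendLinear T L hn g',
        add_sub_add_left_eq_sub, map_sub]
    · rintro ⟨g, rfl⟩
      refine ⟨_, ⟨g, rfl⟩, _, ⟨0, rfl⟩, ?_⟩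
      simp only [vsub_eq_sub]
      rw [extend_eq_add_extendLinear T L hn g, add_sub_cancel_left]
  rw [dimPL, h, LinearMap.finrank_range_of_inj (extendLinear_injective T L hn),
    Module.finrank_fintype_fun_eq_card]

/-- The first coordinate ranges over `|k| ≤ ⌊L n⌋ - 1`, the others over `0, …, n`. If `L n < 1`,
then both sides vanish. -/
theorem card_latticeDomain {d : ℕ} {L : ℝ} {n : ℕ} (hn : 0 < n) :
    Fintype.card (latticeDomain d L n) =
      (2 * (⌊L * n⌋ - 1) + 1).toNat * (n + 1) ^ d := by
  classical
  set m := ⌊L * n⌋ - 1 with hm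
  have ha := mesh_pos hn
  have hna := mul_mesh hn
  have hn' : (0 : ℝ) < n := by exact_mod_cast hn
  set S : Finset (Fin (d + 1) → ℤ) := Fintype.piFinset
    (Fin.cons (Finset.Icc (-m) m) fun _ => Finset.Icc 0 (n : ℤ)) with hS
  have hScard : S.card = (2 * m + 1).toNat * (n + 1) ^ d := by
    rw [hS, Fintype.card_piFinset, Fin.prod_univ_succ]
    simp only [Fin.cons_zero, Fin.cons_succ, Int.card_Icc, Finset.prod_const, Finset.card_univ,
      Fintype.card_fin]
    congr 2
    omega
  have hinj : Function.Injective
      fun k : Fin (d + 1) → ℤ => (WithLp.toLp 2 (fun i => mesh n * (k i : ℝ)) : Pt d) := by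
    intro k k' h
    funext i
    have := congrArg (fun z : Pt d => z i) h
    simpa [ha.ne'] using this
  have himg : latticeDomain d L n =
      (fun k : Fin (d + 1) → ℤ => (WithLp.toLp 2 (fun i => mesh n * (k i : ℝ)) : Pt d)) '' S := by
    have hiff : ∀ k : Fin (d + 1) → ℤ, k ∈ S ↔
        (WithLp.toLp 2 (fun i => mesh n * (k i : ℝ)) : Pt d) ∈ closedDomain d (L - mesh n) := by
      intro k
      rw [hS, Fintype.mem_piFinset, Fin.forall_fin_succ]
      simp only [Fin.cons_zero, Fin.cons_succ, Finset.mem_Icc, closedDomain, Set.mem_ofPred_eq,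
        Set.mem_Icc]
      have key : ∀ j : ℤ, j ≤ m ↔ mesh n * (j : ℝ) ≤ L - mesh n := by
        intro j
        rw [hm, Int.le_sub_one_iff, ← Int.add_one_le_iff, Int.le_floor]
        push_cast
        constructor
        · intro h
          have := mul_le_mul_of_nonneg_left h ha.le
          linear_combination this + L * hna
        · intro h
          have := mul_le_mul_of_nonneg_left h hn'.le
          linear_combination this - ((j : ℝ) + 1) * hna
      refine and_congr ?_ (forall_congr' fun i => ?_)
      · rw [key, and_congr_left_iff]
        intro _
        rw [neg_le, key, Int.cast_neg, mul_neg, neg_le]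
      · refine and_congr ?_ ?_
        · rw [mul_nonneg_iff_of_pos_left ha]; exact_mod_cast Iff.rfl
        · rw [← hna, mul_comm (n : ℝ), mul_le_mul_iff_right₀ ha]; exact_mod_cast Iff.rfl
    ext z
    constructor
    · rintro ⟨hz, hk⟩
      choose k hk using hk
      have e : (WithLp.toLp 2 (fun i => mesh n * (k i : ℝ)) : Pt d) = z := by
        ext i; simp [hk i]
      exact ⟨k, (hiff k).2 (e ▸ hz), e⟩
    · rintro ⟨k, hk, rfl⟩
      exact ⟨(hiff k).1 hk, fun i => ⟨k i, rfl⟩⟩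
  rw [← hScard, ← Nat.card_eq_fintype_card, Nat.card_coe_set_eq, himg,
    Set.ncard_image_of_injective _ hinj, Set.ncard_coe_finset]

theorem card_latticeDomain_bounds {d : ℕ} {L : ℝ} {n : ℕ} (hn : 0 < n) (hLn : 3 ≤ L) :
    L / mesh n ^ (d + 1) ≤ Fintype.card (latticeDomain d L n) ∧
      (Fintype.card (latticeDomain d L n) : ℝ) ≤ 2 ^ (d + 1) * (L / mesh n ^ (d + 1)) := by
  have hn' : (1 : ℝ) ≤ n := by exact_mod_cast hn
  have hLn' : 3 ≤ L * n := by nlinarith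
  rw [card_latticeDomain hn]
  have h1 := Int.floor_le (L * n)
  have h2 := Int.lt_floor_add_one (L * n)
  have h3 : (2 : ℤ) ≤ ⌊L * n⌋ := Int.le_floor.2 (by push_cast; linarith)
  have h4 : (((2 * (⌊L * n⌋ - 1) + 1).toNat : ℕ) : ℝ) = 2 * (⌊L * n⌋ - 1) + 1 := by
    have : (((2 * (⌊L * n⌋ - 1) + 1).toNat : ℤ)) = 2 * (⌊L * n⌋ - 1) + 1 :=
      Int.toNat_of_nonneg (by omega)
    exact_mod_cast congrArg (Int.cast : ℤ → ℝ) this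
  have e : L / mesh n ^ (d + 1) = L * n * n ^ d := by
    rw [mesh, one_div, inv_pow, div_inv_eq_mul, pow_succ]
    ring
  rw [e]
  push_cast
  rw [h4]
  constructor
  · refine mul_le_mul (by linarith) (pow_le_pow_left₀ (by linarith) (by linarith) _)
      (by positivity) (by linarith)
  · calc (2 * ((⌊L * n⌋ : ℝ) - 1) + 1) * ((n : ℝ) + 1) ^ d ≤ 2 * (L * n) * (2 * n) ^ d :=
        mul_le_mul (by linarith) (pow_le_pow_left₀ (by linarith) (by linarith) _)
          (by positivity) (by linarith)
      _ = 2 ^ (d + 1) * (L * n * n ^ d) := by rw [mul_pow]; ring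

/-! ### Asymptotics as `ε ↓ 0` -/


theorem tendsto_rpow_nhdsGT_zero {p : ℝ} (hp : 0 < p) :
    Tendsto (fun ε : ℝ => ε ^ p) (𝓝[>] 0) (𝓝 0) := by
  have := (Real.continuousAt_rpow_const 0 p (Or.inr hp.le)).tendsto
  rw [Real.zero_rpow hp.ne'] at this
  exact this.mono_left nhdsWithin_le_nhds

/-- The quotient `L / a^k` has the order `ε^{-λ-kα}`. -/
theorem SameOrder.div_pow {L a : ℝ → ℝ} {lam α : ℝ} (hL : SameOrder L fun ε => ε ^ (-lam))
    (ha : SameOrder a fun ε => ε ^ α) (k : ℕ) :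
    SameOrder (fun ε => L ε / a ε ^ k) fun ε => ε ^ (-lam - k * α) := by
  obtain ⟨c, hc, C, hC, hL⟩ := hL
  obtain ⟨c', hc', C', hC', ha⟩ := ha
  refine ⟨c / C' ^ k, by positivity, C / c' ^ k, by positivity, ?_⟩
  filter_upwards [hL, ha, self_mem_nhdsWithin] with ε hL ha hε
  have hε : 0 < ε := hε
  have e : ε ^ (-lam - k * α) = ε ^ (-lam) / (ε ^ α) ^ k := by
    rw [Real.rpow_sub hε, mul_comm, Real.rpow_mul hε.le, Real.rpow_natCast]
  have h1 : 0 < ε ^ (-lam) := Real.rpow_pos_of_pos hε _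
  have h2 : 0 < ε ^ α := Real.rpow_pos_of_pos hε _
  have ha0 : 0 < a ε := (mul_pos hc' h2).trans_le ha.1
  rw [e, div_mul_div_comm, div_mul_div_comm, ← mul_pow, ← mul_pow]
  exact ⟨div_le_div₀ ((mul_pos hc h1).le.trans hL.1) hL.1 (by positivity)
      (pow_le_pow_left₀ ha0.le ha.2 k),
    div_le_div₀ (by positivity) hL.2 (by positivity) (pow_le_pow_left₀ (by positivity) ha.1 k)⟩

theorem SameOrder.tendsto_zero {f : ℝ → ℝ} {p : ℝ} (hp : 0 < p) (hf : SameOrder f fun ε => ε ^ p) :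
    Tendsto f (𝓝[>] 0) (𝓝 0) := by
  obtain ⟨c, hc, C, hC, hf⟩ := hf
  have h := tendsto_rpow_nhdsGT_zero hp
  refine tendsto_of_tendsto_of_tendsto_of_le_of_le' (by simpa using h.const_mul c)
    (by simpa using h.const_mul C) (hf.mono fun _ h => h.1) (hf.mono fun _ h => h.2)

theorem SameOrder.tendsto_atTop {f : ℝ → ℝ} {p : ℝ} (hp : 0 < p)
    (hf : SameOrder f fun ε => ε ^ (-p)) : Tendsto f (𝓝[>] 0) atTop := by
  obtain ⟨c, hc, C, hC, hf⟩ := hf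
  exact tendsto_atTop_mono' _ (hf.mono fun _ h => h.1)
    ((tendsto_rpow_neg_nhdsGT_zero (neg_neg_iff_pos.2 hp)).const_mul_atTop hc)

theorem SameOrder.id_mul {f : ℝ → ℝ} {p : ℝ} (hf : SameOrder f fun ε => ε ^ p) :
    SameOrder (fun ε => ε * f ε) fun ε => ε ^ (1 + p) := by
  obtain ⟨c, hc, C, hC, hf⟩ := hf
  refine ⟨c, hc, C, hC, ?_⟩
  filter_upwards [hf, self_mem_nhdsWithin] with ε hf hε
  have hε : 0 < ε := hε
  rw [Real.rpow_add hε, Real.rpow_one]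
  constructor <;> nlinarith [hf.1, hf.2]

theorem SameOrder.of_le_mul {f g k : ℝ → ℝ} {C : ℝ} (hC : 0 < C) (hg : SameOrder g k)
    (h : ∀ᶠ ε in 𝓝[>] (0 : ℝ), g ε ≤ f ε ∧ f ε ≤ C * g ε) : SameOrder f k := by
  obtain ⟨c, hc, C', hC', hg⟩ := hg
  refine ⟨c, hc, C * C', by positivity, ?_⟩
  filter_upwards [hg, h] with ε hg h
  exact ⟨hg.1.trans h.1, h.2.trans (by rw [mul_assoc]; exact mul_le_mul_of_nonneg_left hg.2 hC.le)⟩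

/-- A quantity of positive polynomial order in `ε` stays negligible after multiplication by
`log ε`. -/
theorem SameOrder.tendsto_mul_log {f : ℝ → ℝ} {p : ℝ} (hp : 0 < p)
    (hf : SameOrder f fun ε => ε ^ p) :
    Tendsto (fun ε => f ε * Real.log ε) (𝓝[>] 0) (𝓝 0) := by
  obtain ⟨c, hc, C, hC, hf⟩ := hf
  have h0 : Tendsto (fun ε => C * |Real.log ε * ε ^ p|) (𝓝[>] 0) (𝓝 0) := by
    simpa using (tendsto_log_mul_rpow_nhdsGT_zero hp).abs.const_mul C
  refine squeeze_zero_norm' ?_ h0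
  filter_upwards [hf, self_mem_nhdsWithin] with ε hf hε
  have h1 : 0 < ε ^ p := Real.rpow_pos_of_pos hε _
  have h2 : 0 ≤ f ε := (mul_pos hc h1).le.trans hf.1
  rw [Real.norm_eq_abs, abs_mul, abs_mul, abs_of_nonneg h2, abs_of_pos h1]
  nlinarith [mul_le_mul_of_nonneg_right hf.2 (abs_nonneg (Real.log ε))]

theorem coe_le_mul_log {ε A x : ℝ} {Z : ℝ≥0∞} (hε : 0 < ε) (hx : 0 < x)
    (hZ : ENNReal.ofReal x ≤ Z) (hA : A ≤ ε * Real.log x) :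
    (A : EReal) ≤ (ε : EReal) * ENNReal.log Z := by
  have h1 : ENNReal.log (ENNReal.ofReal x) = (Real.log x : EReal) := by
    rw [ENNReal.log_pos_real (by simpa using hx) ENNReal.ofReal_ne_top, ENNReal.toReal_ofReal hx.le]
  calc (A : EReal) ≤ ((ε * Real.log x : ℝ) : EReal) := EReal.coe_le_coe_iff.2 hA
    _ = (ε : EReal) * ENNReal.log (ENNReal.ofReal x) := by rw [h1, EReal.coe_mul]
    _ ≤ (ε : EReal) * ENNReal.log Z :=
        mul_le_mul_of_nonneg_left (ENNReal.log_le_log hZ) (by exact_mod_cast hε.le)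

section Asymptotics

variable {d : ℕ} {lam α : ℝ} {L : ℝ → ℝ} {n : ℝ → ℕ}

theorem eventually_pos (ha : SameOrder (fun ε => mesh (n ε)) fun ε => ε ^ α) :
    ∀ᶠ ε in 𝓝[>] (0 : ℝ), 0 < n ε := by
  obtain ⟨c, hc, C, hC, ha⟩ := ha
  filter_upwards [ha, self_mem_nhdsWithin] with ε ha hε
  refine Nat.pos_of_ne_zero fun h0 => ?_
  have := mul_pos hc (Real.rpow_pos_of_pos (show 0 < ε from hε) α)
  have h1 := ha.1
  rw [h0, mesh, Nat.cast_zero, div_zero] at h1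
  linarith

theorem sameOrder_card (hlam : 0 < lam) (hL : SameOrder L fun ε => ε ^ (-lam))
    (ha : SameOrder (fun ε => mesh (n ε)) fun ε => ε ^ α) :
    SameOrder (fun ε => (Fintype.card (latticeDomain d (L ε) (n ε)) : ℝ))
      fun ε => ε ^ (-lam - (d + 1) * α) := by
  have h := hL.div_pow ha (d + 1)
  push_cast at h
  refine SameOrder.of_le_mul (C := 2 ^ (d + 1)) (by positivity) h ?_
  filter_upwards [eventually_pos ha, (hL.tendsto_atTop hlam).eventually_ge_atTop 3] with ε hn hL
  exact card_latticeDomain_bounds hn hL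

theorem sameOrder_dimPL (T : CubeSubdivision d) (hlam : 0 < lam)
    (hL : SameOrder L fun ε => ε ^ (-lam))
    (ha : SameOrder (fun ε => mesh (n ε)) fun ε => ε ^ α) :
    SameOrder (fun ε => (dimPL T (L ε) (n ε) : ℝ)) fun ε => ε ^ (-lam - (d + 1) * α) := by
  refine SameOrder.of_le_mul one_pos (sameOrder_card hlam hL ha) ?_
  filter_upwards [eventually_pos ha] with ε hn
  rw [dimPL_eq_card T _ hn]
  exact ⟨le_rfl, by linarith⟩

/-- The logarithm of the lower bound for `Z^ε`, with the constants `E`, `b` and `q` standing for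
the energy, the coercivity constant and the variance of the comparison Gaussian. -/
theorem mul_log_lower_bound {ε E b q : ℝ} {N : ℕ} (hε : 0 < ε) (hq : 0 < q) :
    0 < Real.exp (-E / ε) * (2 * ε) ^ N / (Real.exp (2 * b / ε) * Real.sqrt q ^ N) ∧
    ε * Real.log (Real.exp (-E / ε) * (2 * ε) ^ N / (Real.exp (2 * b / ε) * Real.sqrt q ^ N)) =
      -E - 2 * b + ε * N * (Real.log 2 + Real.log ε - Real.log q / 2) := by
  have hs : 0 < Real.sqrt q := Real.sqrt_pos.2 hq
  refine ⟨by positivity, ?_⟩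
  rw [Real.log_div (by positivity) (by positivity), Real.log_mul (by positivity) (by positivity),
    Real.log_mul (by positivity) (by positivity), Real.log_pow, Real.log_pow, Real.log_exp,
    Real.log_exp, Real.log_sqrt hq.le, Real.log_mul two_ne_zero hε.ne']
  field_simp
  ring

/-- The lower bound for `ε log Z^ε` up to an arbitrary `η`, from boxes of half-width `r = ε` around
the discretized profile. -/
theorem eventually_le_mul_log_Z (T : CubeSubdivision d) {F : ℝ → ℝ} (hF : IsDoubleWell F)
    (hlam : 0 < lam) (hα : 0 < α) (hsum : lam + (d + 1) * α < 1)
    (hL : SameOrder L fun ε => ε ^ (-lam))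
    (ha : SameOrder (fun ε => mesh (n ε)) fun ε => ε ^ α) {η : ℝ} (hη : 0 < η) :
    ∀ᶠ ε : ℝ in 𝓝[>] 0, ((-(Cstar F + 2 * η) : ℝ) : EReal) ≤
      (ε : EReal) * ENNReal.log (Z T F (L ε) (n ε) ε) := by
  obtain ⟨U, a₀, L₀, C, ha₀, hC, hU⟩ := exists_low_energy T hF hη
  obtain ⟨c, hc, hco⟩ := exists_dirichlet_coercive T
  have hn := eventually_pos ha
  have hLt := hL.tendsto_atTop hlam
  have hat := ha.tendsto_zero hα
  have hd : (0 : ℝ) ≤ d := Nat.cast_nonneg d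
  -- `ε N` is of positive polynomial order
  have hN := (sameOrder_card (d := d) hlam hL ha).id_mul
  have hNp : 0 < 1 + (-lam - (d + 1) * α) := by linarith
  have hN0 := hN.tendsto_zero hNp
  have hNlog := hN.tendsto_mul_log hNp
  -- the energy error
  have hLa : Tendsto (fun ε => ε * (L ε / mesh (n ε) ^ 1)) (𝓝[>] 0) (𝓝 0) := by
    refine (hL.div_pow ha 1).id_mul.tendsto_zero ?_
    push_cast
    nlinarith [mul_nonneg hd hα.le]
  -- a polynomial bound for the variance of the comparison Gaussian
  obtain ⟨c₂, _, C₂, hC₂, hq⟩ := hL.div_pow ha (2 * d)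
  set m : ℝ := lam + (2 * d : ℕ) * α with hm
  set Q := 2 * Real.pi * C₂ / c with hQ
  have hQ0 : 0 < Q := by positivity
  have herr : Tendsto (fun ε => -(2 * (c / L ε)) +
      (ε * (Fintype.card (latticeDomain d (L ε) (n ε)) : ℝ) * (Real.log 2 - Real.log Q / 2) +
        (1 + m / 2) * (ε * (Fintype.card (latticeDomain d (L ε) (n ε)) : ℝ) * Real.log ε)) -
      C * (ε * (L ε / mesh (n ε) ^ 1))) (𝓝[>] 0) (𝓝 0) := by
    have h1 := ((hLt.const_div_atTop c).const_mul 2).neg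
    have h2 := (hN0.mul_const (Real.log 2 - Real.log Q / 2)).add (hNlog.const_mul (1 + m / 2))
    simpa using (h1.add h2).sub (hLa.const_mul C)
  filter_upwards [hn, hLt.eventually_ge_atTop (max 3 L₀), hat.eventually_le_const ha₀,
    hN0.eventually_le_const one_pos, hLa.eventually_le_const one_pos, hq,
    herr.eventually_const_le (show -η < 0 by linarith), self_mem_nhdsWithin]
    with ε hn hLε haε hNε hLaε hqε herrε hε
  have hε : 0 < ε := hε
  have hL3 : 3 ≤ L ε := (le_max_left _ _).trans hLε
  have hapos := mesh_pos hn
  have ha1 := mesh_le_one hn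
  rw [pow_one] at hLaε herrε
  have hra : ε ≤ mesh (n ε) := by
    rw [mul_div_assoc', div_le_one hapos] at hLaε
    nlinarith
  obtain ⟨E₁, E₂, hE, hEg⟩ := hU (L ε) (n ε) ε hn haε ((le_max_right _ _).trans hLε) hε.le hra
  have hcard := (card_latticeDomain_bounds (d := d) hn hL3).1
  set N := Fintype.card (latticeDomain d (L ε) (n ε)) with hNdef
  have hNpos : (0 : ℝ) < N := lt_of_lt_of_le (by positivity) hcard
  set b := c * mesh (n ε) ^ (2 * d) / L ε with hb
  have hb0 : 0 < b := by positivity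
  set q := 2 * Real.pi * ε * N / b with hqdef
  have hq0 : 0 < q := by positivity
  have hZ₁ := Z₁_le T hε hb0 (by exact_mod_cast hNpos) (hco (L ε) (n ε) hn (by linarith))
  have hZ := Z_ge T F hε hε.le (fun z => U ((z : Pt d) 0))
    (by positivity) hZ₁ hEg
  obtain ⟨hpos, hlog⟩ := mul_log_lower_bound (E := E₁ + E₂) (b := b) (N := N) hε hq0
  refine coe_le_mul_log hε hpos hZ ?_
  rw [hlog]
  have hbL : b ≤ c / L ε := by
    rw [hb]
    gcongr
    exact mul_le_of_le_one_right hc.le (pow_le_one₀ hapos.le ha1)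
  have hlogq : Real.log q ≤ Real.log Q - m * Real.log ε := by
    have h1 : q ≤ Q * ε ^ (-m) := by
      have e1 : q = 2 * Real.pi / c * (ε * N) * (L ε / mesh (n ε) ^ (2 * d)) := by
        rw [hqdef, hb]; field_simp
      have e2 : Q * ε ^ (-m) = 2 * Real.pi / c * 1 * (C₂ * ε ^ (-m)) := by rw [hQ]; ring
      have e3 : -m = -lam - (2 * d : ℕ) * α := by rw [hm]; ring
      rw [e1, e2, e3]
      gcongr
      exact hqε.2
    have h2 := Real.log_le_log hq0 h1
    rw [Real.log_mul hQ0.ne' (Real.rpow_pos_of_pos hε _).ne', Real.log_rpow hε] at h2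
    linarith
  have hεN : 0 ≤ ε * N := by positivity
  have h3 : ε * N * (Real.log 2 - Real.log Q / 2) + (1 + m / 2) * (ε * N * Real.log ε) ≤
      ε * N * (Real.log 2 + Real.log ε - Real.log q / 2) := by
    have e : ε * N * (Real.log 2 - Real.log Q / 2) + (1 + m / 2) * (ε * N * Real.log ε) =
        ε * N * (Real.log 2 + Real.log ε - (Real.log Q - m * Real.log ε) / 2) := by ring
    rw [e]
    gcongr
  have e4 : C * L ε * (ε / mesh (n ε)) = C * (ε * (L ε / mesh (n ε))) := by ring
  rw [e4] at hE
  linarith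

end Asymptotics

end AllenCahn

theorem proposition4p3 (d : ℕ) (T : AllenCahn.CubeSubdivision d)
    (F : ℝ → ℝ) (hF : AllenCahn.IsDoubleWell F)
    (lam α : ℝ) (hlam : 0 < lam) (hα : 0 < α) (hsum : lam + (d + 1) * α < 1)
    (L : ℝ → ℝ) (n : ℝ → ℕ)
    (hL : AllenCahn.SameOrder L (fun ε => ε ^ (-lam)))
    (ha : AllenCahn.SameOrder (fun ε => AllenCahn.mesh (n ε)) (fun ε => ε ^ α)) :
    AllenCahn.SameOrder (fun ε => (AllenCahn.dimPL T (L ε) (n ε) : ℝ))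
        (fun ε => ε ^ (-lam - (d + 1) * α)) ∧
      ((-AllenCahn.Cstar F : ℝ) : EReal) ≤
        Filter.liminf
          (fun ε : ℝ => (ε : EReal) * ENNReal.log (AllenCahn.Z T F (L ε) (n ε) ε))
          (nhdsWithin 0 (Set.Ioi 0)) := by
  refine ⟨AllenCahn.sameOrder_dimPL T hlam hL ha, EReal.ge_of_forall_gt_iff_ge.1 fun A hA => ?_⟩
  rw [EReal.coe_lt_coe_iff] at hA
  have h := AllenCahn.eventually_le_mul_log_Z T hF hlam hα hsum hL ha
    (η := (-AllenCahn.Cstar F - A) / 2) (by linarith)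
  refine Filter.le_liminf_of_le (by isBoundedDefault) (h.mono fun ε hε => ?_)
  rwa [show -(AllenCahn.Cstar F + 2 * ((-AllenCahn.Cstar F - A) / 2)) = A by ring] at hε
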